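/- Let $\mathbf{k}$ be an algebraically closed field of characteristic zero, $C$ a smooth affine algebraic curve over $\mathbf{k}$, $N=\mathbb{Z}^n$ a lattice ($n\ge 0$) with dual lattice $M$, and $\sigma\subset N_{\mathbb{Q}}$ a pointed (strongly convex) polyhedral cone with dual cone $\sigma^\vee\subset M_{\mathbb{Q}}$. A *$\sigma$-polyhedron* is a Minkowski sum $Q+\sigma$ with $Q$ a nonempty polytope; its support function is $h_\Delta(m)=\min_{v\in\Delta}m(v)$, $m\in\sigma^\vee$. Let $\mathfrak{D}=\sum_{z\in C}\Delta_z\cdot z$ be a $\sigma$-polyhedral divisor on $C$: each $\Delta_z$ is a $\sigma$-polyhedron, and the support $\{z:\Delta_z\ne\sigma\}$ is finite. Put $\mathfrak{D}(m)=\sum_z h_{\Delta_z}(m)\cdot z$ and $$A=A[C,\mathfrak{D}]=\bigoplus_{m\in\sigma^\vee\cap M}H^0(C,\mathcal{O}_C(\lfloor\mathfrak{D}(m)\rfloor))\chi^m\subset\mathbf{k}(C)[M].$$ An element $a$ of a ring is integral over an ideal $J$ if $a^r+\lambda_1a^{r-1}+\dots+\lambda_r=0$ for some $r\ge1$ and $\lambda_i\in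 J^i$; the integral closure $\overline{J}$ is the ideal of all such $a$; $J$ is integrally closed if $\overline J=J$, and normal if $J^e$ is integrally closed for every $e\ge1$. A lattice polyhedron $P$ is normal if for every $e\ge1$ the lattice points of $eP$ are exactly the sums of $e$ lattice points of $P$. Let $I\subset A$ be a homogeneous (nonzero and generated by homogeneous elements $f\chi^m$) integrally closed ideal. Its associated pair $(P,\widetilde{\mathfrak{D}})$, $\widetilde{\mathfrak{D}}=\sum_z\widetilde\Delta_z\cdot z$, is characterized by the following conditions. * $P$ is the sum of $\sigma^\vee$ and a nonempty polytope with vertices in $\sigma^\vee\cap M$. * $\widetilde{\mathfrak{D}}$ is an $\widetilde\omega^\vee$-polyhedral divisor on $C$ (with coefficients in $N_{\mathbb{Q}}\times\mathbb{Q}$), where $\widetilde\omega=\{(m,e)\in M_{\mathbb{Q}}\times\mathbb{Q} : e\ge0,\ m\in eP\}$, with the convention $0P=\sigma^\vee$. * For every $z\in C$, the projection of $\widetilde\Delta_z$ to $N_{\mathbb{Q}}$ is $\Delta_z$, and every vertex $(v,p)$ of $\widetilde\Delta_z$ satisfies $p\le0$. * For every $z\in C$, $\widetilde\Delta_z$ is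 the intersection of $\Delta_z\times\mathbb{Q}$ with finitely many half-spaces $\{(v,p): m(v)+p\ge e\}$ with $m\in P\cap M$, $e\in\mathbb{Z}$. * $I=\bigoplus_{m\in P\cap M}H^0(C,\mathcal{O}_C(\lfloor\widetilde{\mathfrak{D}}(m,1)\rfloor))\chi^m$. For $z\in C$ let $\widetilde P_z\subset M_{\mathbb{Q}}\times\mathbb{Q}$ be the lattice polyhedron $$\widetilde P_z=\mathrm{Conv}\{(m,i)\in(P\cap M)\times\mathbb{Z} : h_{\widetilde\Delta_z}(m,1)\ge-i\}.$$ Then the following hold. 1. If $\widetilde P_z$ is normal for every $z$ in the support of $\widetilde{\mathfrak{D}}$ (and, in case this support is empty, if $P$ is normal), then $I$ is normal. 2. For every integer $e\ge n=\dim N_{\mathbb{Q}}$, the ideal $\overline{I^e}$ is normal. 3. In particular, let $X=\mathrm{Spec}\,B$ be a normal affine surface over $\mathbf{k}$ with a faithful algebraic action of $\mathbf{k}^*$ that is not elliptic, i.e. whose ring of invariants is not $\mathbf{k}$. Then every $\mathbf{k}^*$-stable integrally closed ideal of $B$ is normal. -/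

import Mathlib

open scoped Pointwise

noncomputable section

namespace ComplexityOne

/-! ### Integral closure of ideals -/

section IntegralClosure

variable {A : Type*} [CommRing A]

/-- `a` is integral over the ideal `I`:
`a ^ r + l₁ a ^ (r - 1) + ⋯ + l_r = 0` with `r ≥ 1` and `l_i ∈ I ^ i`. -/
def IsIntegralOverIdeal (I : Ideal A) (a : A) : Prop :=
  ∃ r : ℕ, 1 ≤ r ∧ ∃ l : ℕ → A, (∀ i ∈ Finset.Icc 1 r, l i ∈ I ^ i) ∧
    a ^ r + ∑ i ∈ Finset.Icc 1 r, l i * a ^ (r - i) = 0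

theorem isIntegralOverIdeal_iff (I : Ideal A) (a : A) :
    IsIntegralOverIdeal I a ↔
      IsIntegral (reesAlgebra I) (Polynomial.monomial 1 a : Polynomial A) := by
  classical
  constructor
  · rintro ⟨r, hr, l, hl, h⟩
    have hmem : ∀ i ∈ Finset.Icc 1 r, Polynomial.monomial i (l i) ∈ reesAlgebra I :=
      fun i hi => reesAlgebra.monomial_mem.mpr (hl i hi)
    let c : ℕ → reesAlgebra I := fun i =>
      if hi : i ∈ Finset.Icc 1 r then ⟨Polynomial.monomial i (l i), hmem i hi⟩ else 0
    let q : Polynomial (reesAlgebra I) :=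
      ∑ i ∈ Finset.Icc 1 r, Polynomial.monomial (r - i) (c i)
    refine ⟨Polynomial.X ^ r + q, Polynomial.monic_X_pow_add ?_, ?_⟩
    · refine (Polynomial.degree_sum_le _ _).trans_lt ?_
      rw [Finset.sup_lt_iff (by exact_mod_cast WithBot.bot_lt_coe r)]
      intro i hi
      refine (Polynomial.degree_monomial_le _ _).trans_lt ?_
      have := Finset.mem_Icc.mp hi
      exact_mod_cast (by omega : r - i < r)
    · rw [Polynomial.eval₂_add, Polynomial.eval₂_X_pow, Polynomial.eval₂_finsetSum]
      have key : ∀ i ∈ Finset.Icc 1 r,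
          Polynomial.eval₂ (algebraMap (reesAlgebra I) (Polynomial A))
            (Polynomial.monomial 1 a) (Polynomial.monomial (r - i) (c i))
          = Polynomial.monomial r (l i * a ^ (r - i)) := by
        intro i hi
        have h2 := Finset.mem_Icc.mp hi
        rw [Polynomial.eval₂_monomial, Polynomial.monomial_pow]
        have hc : algebraMap (reesAlgebra I) (Polynomial A) (c i)
            = Polynomial.monomial i (l i) := by
          simp only [c, dif_pos hi]
          rfl
        rw [hc, Polynomial.monomial_mul_monomial]
        congr 2
        omega
      rw [Finset.sum_congr rfl key, Polynomial.monomial_pow, one_mul, ← map_sum, ← map_add, h,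
        map_zero]
  · rintro ⟨p, hp, h⟩
    rcases subsingleton_or_nontrivial A with hA | hA
    · exact ⟨1, le_rfl, 0, fun _ _ => Submodule.zero_mem _, Subsingleton.elim _ _⟩
    have hdeg : 1 ≤ p.natDegree := by
      by_contra h0
      have h0' : p.natDegree = 0 := by omega
      have : p = 1 := hp.natDegree_eq_zero.mp h0'
      rw [this, Polynomial.eval₂_one] at h
      exact one_ne_zero h
    refine ⟨p.natDegree, hdeg, fun i => ((p.coeff (p.natDegree - i) : reesAlgebra I) :
      Polynomial A).coeff i, fun i _ => (p.coeff (p.natDegree - i)).2 i, ?_⟩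
    have h1 := congrArg (fun f : Polynomial A => f.coeff p.natDegree) h
    simp only [Polynomial.eval₂_eq_sum_range, Polynomial.finsetSum_coeff,
      Polynomial.coeff_zero] at h1
    rw [← h1, Finset.sum_range_succ, add_comm]
    congr 1
    · refine Finset.sum_bij' (fun i _ => p.natDegree - i) (fun i _ => p.natDegree - i)
        ?_ ?_ ?_ ?_ ?_
      · intro i hi
        have := Finset.mem_Icc.mp hi
        simp only [Finset.mem_range]; omega
      · intro i hi
        have := Finset.mem_range.mp hi
        simp only [Finset.mem_Icc]; omega
      · intro i hi
        have := Finset.mem_Icc.mp hi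
        omega
      · intro i hi
        have := Finset.mem_range.mp hi
        omega
      · intro i hi
        have h2 := Finset.mem_Icc.mp hi
        rw [Polynomial.monomial_pow, one_mul]
        conv_rhs => rw [show p.natDegree = i + (p.natDegree - i) by omega]
        rw [show i + (p.natDegree - i) - i = p.natDegree - i by omega,
          Polynomial.coeff_mul_monomial]
        rfl
    · rw [Polynomial.monomial_pow, one_mul, hp.coeff_natDegree]
      simp

/-- The integral closure of the ideal `I` in `A`. -/
def idealClosure (I : Ideal A) : Ideal A where
  carrier := {a | IsIntegralOverIdeal I a}
  zero_mem' := by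
    simp only [Set.mem_ofPred_eq, isIntegralOverIdeal_iff, map_zero]
    exact isIntegral_zero
  add_mem' {a b} ha hb := by
    simp only [Set.mem_ofPred_eq, isIntegralOverIdeal_iff, map_add] at ha hb ⊢
    exact ha.add hb
  smul_mem' c a ha := by
    simp only [Set.mem_ofPred_eq, isIntegralOverIdeal_iff] at ha ⊢
    have hc : IsIntegral (reesAlgebra I) (Polynomial.C c : Polynomial A) :=
      isIntegral_algebraMap (R := reesAlgebra I) (x := algebraMap A (reesAlgebra I) c)
    have := hc.mul ha
    rwa [Polynomial.C_mul_monomial] at this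

/-- `I` is integrally closed (complete). -/
def IsIntegrallyClosedIdeal (I : Ideal A) : Prop :=
  ∀ a, IsIntegralOverIdeal I a → a ∈ I

/-- `I` is normal: all its positive powers are integrally closed. -/
def IsNormalIdeal (I : Ideal A) : Prop :=
  ∀ e : ℕ, 1 ≤ e → IsIntegrallyClosedIdeal (I ^ e)

end IntegralClosure

/-! ### Convex geometry in `ℚ^ι`, with the lattice `ℤ^ι` and the pairing `m ⬝ᵥ v` -/

section Convex

variable {ι : Type*} [Fintype ι]

/-- The inclusion of the lattice `ℤ^ι` in `ℚ^ι`. -/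
def castQ (m : ι → ℤ) : ι → ℚ := fun i => (m i : ℚ)

/-- The dual cone `{m | ∀ v ∈ s, 0 ≤ m(v)}`. -/
def dualCone (s : Set (ι → ℚ)) : PointedCone ℚ (ι → ℚ) :=
  PointedCone.dual (dotProductBilin ℚ ℚ) s

theorem mem_dualCone {s : Set (ι → ℚ)} {m : ι → ℚ} :
    m ∈ dualCone s ↔ ∀ v ∈ s, 0 ≤ m ⬝ᵥ v := by
  simp only [dualCone, PointedCone.mem_dual]
  refine forall₂_congr fun v _ => ?_
  rw [dotProduct_comm]
  rfl

/-- `Δ` is the Minkowski sum of the cone `σ` and of a (nonempty) polytope `conv Q` whose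
vertices lie in `F`. -/
def IsTailedPolyhedron (F : Set (ι → ℚ)) (σ : PointedCone ℚ (ι → ℚ)) (Δ : Set (ι → ℚ)) : Prop :=
  ∃ Q : Finset (ι → ℚ), Q.Nonempty ∧ (Q : Set (ι → ℚ)) ⊆ F ∧
    Δ = convexHull ℚ (Q : Set (ι → ℚ)) + (σ : Set (ι → ℚ))

open Classical in
/-- The support function `h_Δ(m) = min_{v ∈ Δ} m(v)` (by convention `0` where there is no
minimum; for a polyhedron `Δ` with tail cone `σ` the minimum exists for all `m ∈ σ^∨`). -/
def supportFn (Δ : Set (ι → ℚ)) (m : ι → ℚ) : ℚ :=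
  if h : ∃ a, IsLeast ((fun v => m ⬝ᵥ v) '' Δ) a then h.choose else 0

theorem supportFn_eq {Δ : Set (ι → ℚ)} {m : ι → ℚ} {a : ℚ}
    (h : IsLeast ((fun v => m ⬝ᵥ v) '' Δ) a) : supportFn Δ m = a := by
  have h' : ∃ a, IsLeast ((fun v => m ⬝ᵥ v) '' Δ) a := ⟨a, h⟩
  rw [supportFn, dif_pos h']
  exact h'.choose_spec.unique h

theorem IsTailedPolyhedron.isLeast_supportFn {F : Set (ι → ℚ)} {σ : PointedCone ℚ (ι → ℚ)}
    {Δ : Set (ι → ℚ)} (hΔ : IsTailedPolyhedron F σ Δ) {m : ι → ℚ}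
    (hm : m ∈ dualCone (σ : Set (ι → ℚ))) :
    IsLeast ((fun v => m ⬝ᵥ v) '' Δ) (supportFn Δ m) := by
  obtain ⟨Q, hQ, -, rfl⟩ := hΔ
  obtain ⟨q, hq, hmin⟩ := Q.exists_min_image (fun v => m ⬝ᵥ v) hQ
  have hl : IsLeast ((fun v => m ⬝ᵥ v) ''
      (convexHull ℚ (Q : Set (ι → ℚ)) + (σ : Set (ι → ℚ)))) (m ⬝ᵥ q) := by
    constructor
    · exact ⟨q, ⟨q, subset_convexHull ℚ _ hq, 0, σ.zero_mem, add_zero q⟩, rfl⟩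
    · rintro _ ⟨_, ⟨x, hx, y, hy, rfl⟩, rfl⟩
      have h1 : m ⬝ᵥ q ≤ m ⬝ᵥ x := by
        have hc : Convex ℚ {x : ι → ℚ | m ⬝ᵥ q ≤ m ⬝ᵥ x} :=
          convex_halfSpace_ge (𝕜 := ℚ) (f := fun x => m ⬝ᵥ x)
            ⟨fun a b => dotProduct_add m a b, fun c a => dotProduct_smul c m a⟩ _
        exact convexHull_min (fun v hv => hmin v hv) hc hx
      have h2 := mem_dualCone.mp hm y hy
      simp only [dotProduct_add]
      linarith
  rwa [supportFn_eq hl]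

/-- A lattice polyhedron `P` is normal if for all `e ≥ 1` the lattice points of `eP` are exactly
the sums of `e` lattice points of `P`. -/
def IsNormalPolyhedron (P : Set (ι → ℚ)) : Prop :=
  ∀ e : ℕ, 1 ≤ e → ∀ m : ι → ℤ, castQ m ∈ (e : ℚ) • P ↔
    ∃ f : Fin e → (ι → ℤ), (∀ j, castQ (f j) ∈ P) ∧ ∑ j, f j = m

/-- The vector `(v, p)` of `ℚ^ι × ℚ = ℚ^(ι ⊕ Unit)` (and similarly over `ℤ`). -/
def extend {R : Type*} (v : ι → R) (p : R) : ι ⊕ Unit → R := Sum.elim v fun _ => p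

/-- The cone `{(m, e) | e ≥ 0, m ∈ eP}` of `ℚ^ι × ℚ`, where `0P` means `σ^∨`. -/
def reesCone (σ : PointedCone ℚ (ι → ℚ)) (P : Set (ι → ℚ)) : Set (ι ⊕ Unit → ℚ) :=
  {x | ∃ (m : ι → ℚ) (e : ℚ), x = extend m e ∧
    (e = 0 ∧ m ∈ dualCone (σ : Set (ι → ℚ)) ∨ 0 < e ∧ m ∈ e • P)}

end Convex

/-! ### Polyhedral divisors on a smooth affine curve

The curve is `C = Spec R` with `R = k[C]` a Dedekind domain; `K = k(C)` is its fraction field, the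
points `z ∈ C` are the height one primes of `R`, and
`z.valuation K f = WithZero.exp (- ord_z f)`. -/

section Divisors

open IsDedekindDomain

variable {R : Type*} [CommRing R] [IsDedekindDomain R]
variable (K : Type*) [Field K] [Algebra R K] [IsFractionRing R K]
variable {ι : Type*} [Fintype ι]

/-- `H⁰(C, 𝒪_C(⌊D⌋))` for a rational divisor `D`: the `f ∈ k(C)` that are zero or satisfy
`ord_z f + ⌊D_z⌋ ≥ 0` for all `z`. -/
def globalSections (D : HeightOneSpectrum R → ℚ) : Submodule R K where
  carrier := {f | ∀ z : HeightOneSpectrum R, z.valuation K f ≤ WithZero.exp ⌊D z⌋}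
  zero_mem' z := by simp
  add_mem' {f g} hf hg z := (Valuation.map_add _ f g).trans (max_le (hf z) (hg z))
  smul_mem' c f hf z := by
    rw [Algebra.smul_def, map_mul]
    exact (mul_le_of_le_one_left' (z.valuation_le_one c)).trans (hf z)

variable (R) in
/-- A `σ`-polyhedral divisor `∑ Δ_z · z` on `C = Spec R`. -/
structure PolyhedralDivisor (σ : PointedCone ℚ (ι → ℚ)) where
  /-- The coefficient `Δ_z`. -/
  coeff : HeightOneSpectrum R → Set (ι → ℚ)
  isTailedPolyhedron : ∀ z, IsTailedPolyhedron Set.univ σ (coeff z)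
  finite_support : {z | coeff z ≠ (σ : Set (ι → ℚ))}.Finite

namespace PolyhedralDivisor

variable {σ : PointedCone ℚ (ι → ℚ)} (D : PolyhedralDivisor R σ)

/-- The support of a polyhedral divisor. -/
def support : Set (HeightOneSpectrum R) := {z | D.coeff z ≠ (σ : Set (ι → ℚ))}

/-- The evaluation `D(m) = ∑ h_{Δ_z}(m) · z`, for `m ∈ σ^∨`. -/
def eval (m : ι → ℤ) : HeightOneSpectrum R → ℚ := fun z => supportFn (D.coeff z) (castQ m)

theorem eval_zero (z : HeightOneSpectrum R) : D.eval 0 z = 0 := by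
  have h := (D.isTailedPolyhedron z).isLeast_supportFn
    (m := castQ (0 : ι → ℤ)) (mem_dualCone.mpr fun v _ => by simp [castQ, dotProduct])
  obtain ⟨v, -, hv⟩ := h.1
  simp only [eval, ← hv]
  simp [castQ, dotProduct]

theorem eval_add_le {m m' : ι → ℤ} (hm : castQ m ∈ dualCone (σ : Set (ι → ℚ)))
    (hm' : castQ m' ∈ dualCone (σ : Set (ι → ℚ))) (z : HeightOneSpectrum R) :
    D.eval m z + D.eval m' z ≤ D.eval (m + m') z := by
  have hc : castQ (m + m') = castQ m + castQ m' := by ext i; simp [castQ]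
  have h1 := (D.isTailedPolyhedron z).isLeast_supportFn hm
  have h2 := (D.isTailedPolyhedron z).isLeast_supportFn hm'
  have h3 := (D.isTailedPolyhedron z).isLeast_supportFn
    (hc ▸ add_mem hm hm' : castQ (m + m') ∈ dualCone (σ : Set (ι → ℚ)))
  obtain ⟨v, hv, hv'⟩ := h3.1
  have a1 := h1.2 ⟨v, hv, rfl⟩
  have a2 := h2.2 ⟨v, hv, rfl⟩
  simp only [eval, ← hv']
  rw [hc, add_dotProduct]
  exact add_le_add a1 a2

open Classical in
/-- The graded piece `A_m`: `H⁰(C, 𝒪_C(⌊D(m)⌋))` if `m ∈ σ^∨`, and `0` otherwise. -/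
def piece (m : ι → ℤ) : Submodule R K :=
  if castQ m ∈ dualCone (σ : Set (ι → ℚ)) then globalSections K (D.eval m) else ⊥

theorem mul_mem_piece {m m' : ι → ℤ} {f g : K} (hf : f ∈ D.piece K m)
    (hg : g ∈ D.piece K m') : f * g ∈ D.piece K (m + m') := by
  by_cases hm : castQ m ∈ dualCone (σ : Set (ι → ℚ))
  swap
  · rw [piece, if_neg hm, Submodule.mem_bot] at hf
    rw [hf, zero_mul]
    exact Submodule.zero_mem _
  by_cases hm' : castQ m' ∈ dualCone (σ : Set (ι → ℚ))
  swap
  · rw [piece, if_neg hm', Submodule.mem_bot] at hg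
    rw [hg, mul_zero]
    exact Submodule.zero_mem _
  have hc : castQ (m + m') = castQ m + castQ m' := by ext i; simp [castQ]
  rw [piece, if_pos hm] at hf
  rw [piece, if_pos hm'] at hg
  rw [piece, if_pos (hc ▸ add_mem hm hm')]
  intro z
  rw [map_mul]
  refine (mul_le_mul' (hf z) (hg z)).trans ?_
  rw [← WithZero.exp_add, WithZero.exp_le_exp]
  exact (Int.le_floor_add _ _).trans (Int.floor_le_floor (D.eval_add_le hm hm' z))

theorem algebraMap_mem_piece (r : R) : algebraMap R K r ∈ D.piece K 0 := by
  rw [piece, if_pos (mem_dualCone.mpr fun v _ => by simp [castQ, dotProduct])]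
  intro z
  rw [D.eval_zero z]
  simpa using z.valuation_le_one r

/-- The `M`-graded algebra
`A[C, D] = ⨁_{m ∈ σ^∨ ∩ M} H⁰(C, 𝒪_C(⌊D(m)⌋)) χ^m ⊆ k(C)[M]`, where `M = ℤ^ι`. -/
def algebra : Subalgebra R (AddMonoidAlgebra K (ι → ℤ)) where
  carrier := {F | ∀ m, F.coeff m ∈ D.piece K m}
  mul_mem' {F G} hF hG m := by
    classical
    rw [AddMonoidAlgebra.coeff_mul]
    refine Submodule.sum_mem _ fun a _ => Submodule.sum_mem _ fun b _ => ?_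
    dsimp only
    split_ifs with h
    · exact h ▸ D.mul_mem_piece K (hF a) (hG b)
    · exact Submodule.zero_mem _
  add_mem' {F G} hF hG m := by
    rw [AddMonoidAlgebra.coeff_add]
    exact Submodule.add_mem _ (hF m) (hG m)
  algebraMap_mem' r m := by
    classical
    rw [AddMonoidAlgebra.coe_algebraMap, Function.comp_apply, AddMonoidAlgebra.coeff_single,
      Finsupp.single_apply]
    split_ifs with h
    · exact h ▸ D.algebraMap_mem_piece K r
    · exact Submodule.zero_mem _

/-- An ideal of `A[C, D]` is homogeneous if it is nonzero and generated by homogeneous elements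
`f χ^m`. -/
def IsHomogeneousIdeal (I : Ideal (D.algebra K)) : Prop :=
  I ≠ ⊥ ∧ ∃ S : Set (D.algebra K),
    (∀ a ∈ S, ∃ (m : ι → ℤ) (f : K),
      (a : AddMonoidAlgebra K (ι → ℤ)) = AddMonoidAlgebra.single m f) ∧
    I = Ideal.span S

/-- `(P, D')` is the pair associated with the ideal `I` of `A[C, D]`. -/
structure IsAssociatedPair (I : Ideal (D.algebra K)) (P : Set (ι → ℚ))
    (D' : PolyhedralDivisor R (dualCone (reesCone σ P))) : Prop where
  /-- `P` is the sum of `σ^∨` and of a polytope with vertices in `σ^∨ ∩ M`. -/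
  polyhedron : IsTailedPolyhedron
    {x | x ∈ dualCone (σ : Set (ι → ℚ)) ∧ ∃ m : ι → ℤ, x = castQ m}
    (dualCone (σ : Set (ι → ℚ))) P
  /-- `Δ_z` is the projection of `Δ'_z`. -/
  projection : ∀ z, D.coeff z = (fun w i => w (Sum.inl i)) '' D'.coeff z
  /-- Every vertex `(v, p)` of `Δ'_z` satisfies `p ≤ 0`. -/
  vertex : ∀ z (v : ι → ℚ) (p : ℚ), extend v p ∈ Set.extremePoints ℚ (D'.coeff z) → p ≤ 0
  /-- `Δ'_z` is the intersection in `Δ_z × ℚ` of finitely many half-spaces `m(v) + p ≥ e`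
  with `m ∈ P ∩ M` and `e ∈ ℤ`. -/
  halfSpaces : ∀ z, ∃ H : Finset ((ι → ℤ) × ℤ), (∀ h ∈ H, castQ h.1 ∈ P) ∧
    ∀ (v : ι → ℚ) (p : ℚ), extend v p ∈ D'.coeff z ↔
      v ∈ D.coeff z ∧ ∀ h ∈ H, (h.2 : ℚ) ≤ castQ h.1 ⬝ᵥ v + p
  /-- `I = ⨁_{m ∈ P ∩ M} H⁰(C, 𝒪_C(⌊D'(m, 1)⌋)) χ^m`. -/
  ideal_eq : ((↑) : D.algebra K → AddMonoidAlgebra K (ι → ℤ)) '' (I : Set (D.algebra K)) =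
    {F | ∀ m, F.coeff m ≠ 0 →
      castQ m ∈ P ∧ F.coeff m ∈ globalSections K (D'.eval (extend m 1))}

/-- For a divisor `D'` with coefficients `Δ'_z`, the polyhedron
`P'_z = conv {(m, i) ∈ (P ∩ M) × ℤ | h_{Δ'_z}(m, 1) ≥ -i}`. -/
def localPolyhedron {τ : PointedCone ℚ (ι ⊕ Unit → ℚ)} (D' : PolyhedralDivisor R τ)
    (P : Set (ι → ℚ)) (z : HeightOneSpectrum R) : Set (ι ⊕ Unit → ℚ) :=
  convexHull ℚ {x | ∃ (m : ι → ℤ) (i : ℤ), x = castQ (extend m i) ∧ castQ m ∈ P ∧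
    -(i : ℚ) ≤ D'.eval (extend m 1) z}

end PolyhedralDivisor

end Divisors

/-! ### Actions of the multiplicative group on affine varieties -/

section Action

variable {k B : Type*} [Field k] [CommRing B] [Algebra k B]

/-- The action of `k^*` on `Spec B` given by `ρ` is algebraic: `t ↦ ρ t b` is a Laurent polynomial
in `t` with coefficients in `B`, for all `b`. -/
def IsAlgebraicAction (ρ : kˣ →* (B ≃ₐ[k] B)) : Prop :=
  ∀ b : B, ∃ c : ℤ →₀ B, ∀ t : kˣ, ρ t b = c.sum fun m x => ((t ^ m : kˣ) : k) • x

/-- The weight space `B_m`. -/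
def weightSpace (ρ : kˣ →* (B ≃ₐ[k] B)) (m : ℤ) : Submodule k B where
  carrier := {b | ∀ t : kˣ, ρ t b = ((t ^ m : kˣ) : k) • b}
  zero_mem' t := by simp
  add_mem' {a b} ha hb t := by rw [map_add, ha t, hb t, smul_add]
  smul_mem' c a ha t := by rw [map_smul, ha t, smul_comm]

/-- The action is elliptic if `B_0 = k`. -/
def IsElliptic (ρ : kˣ →* (B ≃ₐ[k] B)) : Prop := weightSpace ρ 0 = 1

end Action

end ComplexityOne

end

open ComplexityOne

open scoped Pointwise

noncomputable section

namespace ComplexityOne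

/-! ### Saturated submonoids of a lattice generated in degrees zero and one -/

section Saturation

/-! All three statements concern graded ideals in a graded subalgebra of `K[ℤ^n]`, with `K` the
function field of a curve, and they are decided one point `z` of the curve at a time. To a graded
ideal `J` attach the set `orders z J` of pairs (degree, upper bound for the order at `z`). These
sets determine `J` (`mem_of_forall_mem_orders`) and turn products of ideals into sums of sets
(`exists_add_eq_of_mem_orders_mul`, `add_mem_orders_mul`). When monomials can be divided by integers
inside the algebra (`IsRootClosed`), the orders of the integral closure of `J` are the `x` such that
some `N • x`, `N ≥ 1`, is an order of `J ^ N` (`exists_nsmul_mem_orders_pow`,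
`mem_orders_idealClosure`). Integral closures stay graded because the torus acts on everything.
Normality thus becomes a statement on lattice points (`isNormalIdeal_of_orders`): if `N • x` is an
order of `J ^ (N * s)`, then `x` is one of `J ^ s`.

For the first statement, the orders of `I` at `z` are the lattice points of the local polyhedron, so
normality of that polyhedron is the required property. Off the support only the decomposition of
degrees in `P` matters, and it is inherited from any point of the support.

For the second, the orders of all powers of `I` at `z` form a monoid in `ℤ^(n+2)`, graded by the
exponent and generated in degrees 0 and 1. In the saturation of such a monoid of rank `d + 1`, every
element of degree at least `d` splits off an element of degree 1 (`exists_degree_one_sub_mem`).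
Carathéodory's theorem settles all cases but that of a full simplex of degree-one vertices and an
element of degree exactly `d`, where a descent on the determinant concludes. With `d = n + 1` this
shows that from degree `n` on the saturated pieces add up, hence the result.

For the third, a vector of weight 1 in the fraction field identifies `B` with a graded root closed
subalgebra of Laurent polynomials in one variable over the field of invariants. The invariants form
a Dedekind domain that is not a field, so the second statement applies with `n = e = 1`, without
choosing a polyhedral divisor. -/

/-- The elements having a positive multiple in `T`. -/
def saturation {V : Type*} [AddCommMonoid V] (T : AddSubmonoid V) : AddSubmonoid V where
  carrier := {x | ∃ N : ℕ, 1 ≤ N ∧ N • x ∈ T}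
  zero_mem' := ⟨1, le_rfl, by simp⟩
  add_mem' := by
    rintro x y ⟨N, hN, hx⟩ ⟨N', hN', hy⟩
    refine ⟨N * N', Nat.mul_pos hN hN', ?_⟩
    rw [smul_add]
    refine add_mem ?_ ?_
    · rw [mul_comm, mul_smul]; exact nsmul_mem hx _
    · rw [mul_smul]; exact nsmul_mem hy _

theorem mem_saturation {V : Type*} [AddCommMonoid V] {T : AddSubmonoid V} {x : V} :
    x ∈ saturation T ↔ ∃ N : ℕ, 1 ≤ N ∧ N • x ∈ T := Iff.rfl

theorem le_saturation {V : Type*} [AddCommMonoid V] (T : AddSubmonoid V) : T ≤ saturation T :=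
  fun x hx => ⟨1, le_rfl, by simpa using hx⟩

theorem mem_saturation_of_nsmul_mem {V : Type*} [AddCommMonoid V] {T : AddSubmonoid V} {x : V}
    {N : ℕ} (hN : 1 ≤ N) (h : N • x ∈ saturation T) : x ∈ saturation T := by
  obtain ⟨N', hN', h'⟩ := h
  exact ⟨N' * N, Nat.mul_pos hN' hN, by rwa [mul_smul]⟩

theorem sub_nsmul' {V : Type*} [AddCommGroup V] (v : V) {a b : ℕ} (h : b ≤ a) :
    (a - b) • v = a • v - b • v := by
  rw [sub_nsmul v h, sub_eq_add_neg]

/-- A linear relation between the terms of a combination with coefficients in `ℕ` allows one to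
remove a term, after multiplication by a positive integer. -/
theorem exists_nsmul_eq_sum_erase {α V : Type*} [DecidableEq α] [AddCommGroup V] (s : Finset α)
    (T : α → V) (n : α → ℕ) (a : α → ℤ) (ha : ∑ i ∈ s, a i • T i = 0) (hne : ∃ i ∈ s, a i ≠ 0) :
    ∃ j ∈ s, ∃ c : ℕ, 1 ≤ c ∧ ∃ n' : α → ℕ,
      c • ∑ i ∈ s, n i • T i = ∑ i ∈ s.erase j, n' i • T i := by
  wlog hpos : ∃ i ∈ s, 0 < a i generalizing a
  · obtain ⟨i, hi, hi'⟩ := hne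
    refine this (fun i => - a i) (by simp [ha]) ⟨i, hi, by simpa using hi'⟩ ⟨i, hi, ?_⟩
    push Not at hpos
    have := hpos i hi
    omega
  obtain ⟨i₀, hi₀, hi₀'⟩ := hpos
  -- Subtracting `n j / a j` times the relation kills the `j`-th coefficient; minimality of this
  -- ratio keeps the others nonnegative.
  obtain ⟨j, hj, hmin⟩ := (s.filter fun i => 0 < a i).exists_min_image
    (fun i => (n i : ℚ) / a i) ⟨i₀, by simp [hi₀, hi₀']⟩
  obtain ⟨hjs, hja⟩ := Finset.mem_filter.mp hj
  have hnn : ∀ i ∈ s, 0 ≤ a j * n i - n j * a i := by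
    intro i hi
    rcases le_or_gt (a i) 0 with h | h
    · have h1 : 0 ≤ a j * n i := by positivity
      have h2 : (n j : ℤ) * a i ≤ 0 := mul_nonpos_of_nonneg_of_nonpos (by positivity) h
      omega
    · have := hmin i (Finset.mem_filter.mpr ⟨hi, h⟩)
      have h1 : (0 : ℚ) < a i := by exact_mod_cast h
      have h2 : (0 : ℚ) < a j := by exact_mod_cast hja
      rw [div_le_div_iff₀ h2 h1] at this
      have h3 : (n j : ℤ) * a i ≤ n i * a j := by exact_mod_cast this
      linarith
  refine ⟨j, hjs, (a j).toNat, by omega, fun i => (a j * n i - n j * a i).toNat, ?_⟩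
  have e1 : (a j).toNat • ∑ i ∈ s, n i • T i = ∑ i ∈ s, (a j * n i - n j * a i) • T i := by
    have : ∑ i ∈ s, (a j * n i - n j * a i) • T i
        = a j • ∑ i ∈ s, n i • T i - (n j : ℤ) • ∑ i ∈ s, a i • T i := by
      rw [Finset.smul_sum, Finset.smul_sum, ← Finset.sum_sub_distrib]
      refine Finset.sum_congr rfl fun i _ => ?_
      rw [sub_smul, mul_smul, mul_smul, natCast_zsmul]
    rw [this, ha, smul_zero, sub_zero, ← natCast_zsmul, Int.toNat_of_nonneg hja.le]
  rw [e1, ← Finset.add_sum_erase s _ hjs]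
  rw [show (a j * n j - n j * a j) = 0 by ring, zero_smul, zero_add]
  refine Finset.sum_congr rfl fun i hi => ?_
  rw [← natCast_zsmul, Int.toNat_of_nonneg (hnn i (Finset.mem_of_mem_erase hi))]

/-- Carathéodory's theorem for the cones of a lattice. -/
theorem exists_nsmul_eq_sum_card_le {κ : Type*} [Fintype κ] (x : κ → ℤ) (s : Finset (κ → ℤ)) :
    (∃ N : ℕ, 1 ≤ N ∧ ∃ n : (κ → ℤ) → ℕ, N • x = ∑ t ∈ s, n t • t) →
    ∃ s' ⊆ s, s'.card ≤ Fintype.card κ ∧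
      ∃ N : ℕ, 1 ≤ N ∧ ∃ n : (κ → ℤ) → ℕ, N • x = ∑ t ∈ s', n t • t := by
  classical
  induction s using Finset.strongInduction with
  | H s ih =>
    rintro ⟨N, hN, n, h⟩
    by_cases hc : s.card ≤ Fintype.card κ
    · exact ⟨s, subset_rfl, hc, N, hN, n, h⟩
    -- More vectors than the rank of the lattice satisfy an integral relation, which removes one of
    -- them.
    have hli : ¬ LinearIndependent ℤ (fun t : s => (t : κ → ℤ)) := by
      intro hli
      have := hli.fintype_card_le_finrank
      simp only [Fintype.card_coe, Module.finrank_fintype_fun_eq_card] at this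
      exact hc this
    obtain ⟨g, hg, i, hi⟩ := Fintype.not_linearIndependent_iff.mp hli
    let a : (κ → ℤ) → ℤ := fun t => if ht : t ∈ s then g ⟨t, ht⟩ else 0
    have ha : ∑ t ∈ s, a t • t = 0 := by
      rw [← hg, ← Finset.sum_coe_sort s]
      exact Finset.sum_congr rfl fun t _ => by simp [a]
    obtain ⟨j, hj, c, hc1, n', hn'⟩ := exists_nsmul_eq_sum_erase s (fun t => t) n a ha
      ⟨i, i.2, by simpa [a] using hi⟩
    obtain ⟨s', hs', hcard, hr⟩ := ih (s.erase j) (Finset.erase_ssubset hj)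
      ⟨c * N, Nat.mul_pos hc1 hN, n', by rw [mul_smul, h, hn']⟩
    exact ⟨s', hs'.trans (Finset.erase_subset _ _), hcard, hr⟩

/-- If a generator of degree 1 has coefficient at least `N`, it can be subtracted from `x`, since `N
• (x - t i)` is still a nonnegative combination. Otherwise these coefficients are at most `N - 1`,
and comparing degrees bounds `deg x`. -/
theorem exists_sub_mem_or_mul_le {α V : Type*} [AddCommGroup V] {T : AddSubmonoid V}
    (deg : V →+ ℤ) {x : V} (s : Finset α) (t : α → V)
    (ht : ∀ i ∈ s, t i ∈ saturation T ∧ (deg (t i) = 0 ∨ deg (t i) = 1)) {N : ℕ} (hN : 1 ≤ N)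
    {n : α → ℕ} (h : N • x = ∑ i ∈ s, n i • t i) :
    (∃ v ∈ saturation T, deg v = 1 ∧ x - v ∈ saturation T) ∨
      N * deg x ≤ (N - 1) * (s.filter fun i => deg (t i) = 1).card := by
  classical
  by_cases hbig : ∃ i ∈ s, deg (t i) = 1 ∧ N ≤ n i
  · left
    obtain ⟨i, hi, hdi, hni⟩ := hbig
    refine ⟨t i, (ht i hi).1, hdi, mem_saturation_of_nsmul_mem hN ?_⟩
    rw [smul_sub, h, ← Finset.add_sum_erase s _ hi, add_sub_right_comm]
    refine add_mem ?_ (sum_mem fun j hj => nsmul_mem (ht j (Finset.mem_of_mem_erase hj)).1 _)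
    rw [← sub_nsmul' _ hni]
    exact nsmul_mem (ht i hi).1 _
  · right
    push Not at hbig
    have e : (N : ℤ) * deg x = ∑ i ∈ s, (n i : ℤ) * deg (t i) := by
      have := congrArg deg h
      simpa [map_sum, map_nsmul] using this
    have hterm : ∀ i ∈ s, (n i : ℤ) * deg (t i) ≤ if deg (t i) = 1 then (N - 1 : ℤ) else 0 := by
      intro i hi
      rcases (ht i hi).2 with h0 | h1
      · simp [h0]
      · have := hbig i hi h1
        rw [h1, if_pos rfl]
        omega
    rw [e]
    refine (Finset.sum_le_sum hterm).trans ?_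
    rw [← Finset.sum_filter, Finset.sum_const, nsmul_eq_mul, mul_comm]

/-- In a lattice of rank `d + 1`, an element of degree at least `d` of a saturated monoid generated
in degrees `0` and `1` is the sum of an element of degree `1` and of an element of the monoid. -/
theorem exists_degree_one_sub_mem {κ : Type*} [Fintype κ] (T : AddSubmonoid (κ → ℤ))
    (deg : (κ → ℤ) →+ ℤ)
    (hT : T ≤ AddSubmonoid.closure {t | t ∈ T ∧ (deg t = 0 ∨ deg t = 1)})
    {d : ℕ} (hd : 1 ≤ d) (hκ : Fintype.card κ = d + 1) {x : κ → ℤ} (hx : x ∈ saturation T)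
    (hdx : d ≤ deg x) :
    ∃ v ∈ saturation T, deg v = 1 ∧ x - v ∈ saturation T := by
  classical
  by_contra hcon
  -- Descent on the volume of a simplex with vertices of degree 1 whose cone contains `x`.
  have key : ∀ D : ℕ, ∀ t : κ → κ → ℤ, (Matrix.of t).det.natAbs = D →
      (∀ i, t i ∈ saturation T ∧ deg (t i) = 1) →
      (∃ N : ℕ, 1 ≤ N ∧ ∃ n : κ → ℕ, N • x = ∑ i, n i • t i) → False := by
    intro D
    induction D using Nat.strong_induction_on with
    | _ D ih =>
      rintro t hD ht ⟨N, hN, n, h⟩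
      have hN' : (1 : ℤ) ≤ N := by exact_mod_cast hN
      by_cases hdet : (Matrix.of t).det = 0
      · obtain ⟨a, ha0, ha⟩ := Matrix.exists_vecMul_eq_zero_iff.mpr hdet
        have ha' : ∑ i ∈ Finset.univ, a i • t i = 0 := by
          rw [← ha, Matrix.vecMul_eq_sum]
          rfl
        obtain ⟨i, hi⟩ := Function.ne_iff.mp ha0
        obtain ⟨j, hj, c, hc, n', hn'⟩ := exists_nsmul_eq_sum_erase Finset.univ t n a ha'
          ⟨i, Finset.mem_univ _, hi⟩
        rw [← h, ← mul_smul] at hn'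
        have hcN : 1 ≤ c * N := Nat.mul_pos hc hN
        -- In the degenerate case a vertex has been dropped; the `d` remaining ones would force `deg
        -- x < d`.
        rcases exists_sub_mem_or_mul_le deg _ t (fun i _ => ⟨(ht i).1, Or.inr (ht i).2⟩)
          hcN hn' with h1 | h1
        · exact hcon h1
        · have h2 := Finset.card_filter_le (Finset.univ.erase j) fun i => deg (t i) = 1
          rw [Finset.card_erase_of_mem hj, Finset.card_univ, hκ, Nat.add_sub_cancel] at h2
          have h2' : ((Finset.filter (fun i => deg (t i) = 1) (Finset.univ.erase j)).card : ℤ) ≤ d := by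
            exact_mod_cast h2
          have : (1 : ℤ) ≤ (c * N : ℕ) := by exact_mod_cast hcN
          have hd' : (1 : ℤ) ≤ d := by exact_mod_cast hd
          nlinarith
      · have hlt : ∀ i, n i < N := by
          intro i
          by_contra hni
          push Not at hni
          refine hcon ⟨t i, (ht i).1, (ht i).2, mem_saturation_of_nsmul_mem hN ?_⟩
          rw [smul_sub, h, ← Finset.add_sum_erase _ _ (Finset.mem_univ i), add_sub_right_comm,
            ← sub_nsmul' _ hni]
          exact add_mem (nsmul_mem (ht i).1 _) (sum_mem fun j _ => nsmul_mem (ht j).1 _)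
        have e : (N : ℤ) * deg x = ∑ i, (n i : ℤ) := by
          have := congrArg deg h
          rw [map_nsmul, map_sum] at this
          simp only [map_nsmul, fun i => (ht i).2] at this
          simpa using this
        have hsum : ∑ i, (n i : ℤ) ≤ (d + 1) * (N - 1) := by
          refine (Finset.sum_le_card_nsmul Finset.univ _ ((N : ℤ) - 1)
            fun i _ => by have := hlt i; omega).trans ?_
          rw [Finset.card_univ, hκ, nsmul_eq_mul]
          push_cast
          exact le_rfl
        -- All coefficients are below `N`, so `deg x < d + 1`: only the boundary case survives.
        have hdeg : deg x = d := by
          have : (N : ℤ) * deg x < N * (d + 1) := by nlinarith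
          have := lt_of_mul_lt_mul_left this (by omega)
          omega
        -- The other `d` coefficients sum to at most `d * (N - 1)`, while the total is `N * d`. This
        -- positivity makes the descent strict.
        have hpos : ∀ i, 1 ≤ n i := by
          intro i
          have h1 : ∑ j ∈ Finset.univ.erase i, (n j : ℤ) ≤ d * (N - 1) := by
            refine (Finset.sum_le_card_nsmul _ _ ((N : ℤ) - 1)
              fun i _ => by have := hlt i; omega).trans ?_
            rw [Finset.card_erase_of_mem (Finset.mem_univ i), Finset.card_univ, hκ, nsmul_eq_mul]
            simp
          rw [← Finset.add_sum_erase _ _ (Finset.mem_univ i), hdeg] at e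
          have hd' : (1 : ℤ) ≤ d := by exact_mod_cast hd
          have : (1 : ℤ) ≤ n i := by linarith
          exact_mod_cast this
        have hκ0 : Nonempty κ := Fintype.card_pos_iff.mp (by omega)
        -- The vertex with the smallest coefficient is replaced by `w`, so that the new coefficients
        -- `n i - n j` of `x` stay nonnegative.
        obtain ⟨j, -, hmin⟩ := Finset.univ.exists_min_image n Finset.univ_nonempty
        -- The reflection of `x`: its coefficients are `(N - n i) / N`, and its degree is `(d + 1) -
        -- d = 1`.
        set w : κ → ℤ := ∑ i, t i - x with hw
        have hNw : N • w = ∑ i, (N - n i) • t i := by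
          rw [hw, smul_sub, h, Finset.smul_sum, ← Finset.sum_sub_distrib]
          exact Finset.sum_congr rfl fun i _ => (sub_nsmul' _ (hlt i).le).symm
        have hwS : w ∈ saturation T := by
          refine mem_saturation_of_nsmul_mem hN ?_
          rw [hNw]
          exact sum_mem fun i _ => nsmul_mem (ht i).1 _
        have hwdeg : deg w = 1 := by
          rw [hw, map_sub, map_sum, hdeg, Finset.sum_congr rfl fun i _ => (ht i).2]
          simp [hκ]
        -- Modulo the other rows, `N • w` is `(N - n j) • t j`, so the determinant is scaled by a
        -- factor less than 1.
        have hdet' : (N : ℤ) * ((Matrix.of t).updateRow j w).det = (N - n j : ℤ) * (Matrix.of t).det := by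
          have h1 := Matrix.det_updateRow_sum (Matrix.of t) j fun i => (N - n i : ℤ)
          rw [smul_eq_mul] at h1
          rw [← h1, ← Matrix.det_updateRow_smul]
          congr 2
          rw [natCast_zsmul, hNw]
          refine Finset.sum_congr rfl fun i _ => ?_
          rw [← natCast_zsmul, Nat.cast_sub (hlt i).le]
          rfl
        refine ih ((Matrix.of t).updateRow j w).det.natAbs ?_ ((Matrix.of t).updateRow j w) rfl ?_ ?_
        · rw [← hD]
          have h1 := congrArg Int.natAbs hdet'
          rw [Int.natAbs_mul, Int.natAbs_mul, Int.natAbs_natCast,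
            show ((N : ℤ) - n j).natAbs = N - n j by have := hlt j; omega] at h1
          have h2 : 0 < (Matrix.of t).det.natAbs := Int.natAbs_pos.mpr hdet
          have h3 := hpos j
          have h4 : (N - n j) * (Matrix.of t).det.natAbs < N * (Matrix.of t).det.natAbs :=
            Nat.mul_lt_mul_of_pos_right (by omega) h2
          rw [← h1] at h4
          exact lt_of_mul_lt_mul_left h4 (Nat.zero_le _)
        · intro i
          by_cases hij : i = j
          · subst hij; rw [Matrix.updateRow_self]; exact ⟨hwS, hwdeg⟩
          · rw [Matrix.updateRow_ne hij]; exact ht i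
        · refine ⟨N - n j, by have := hlt j; omega, fun i => if i = j then n j else n i - n j, ?_⟩
          have h1 : (N - n j) • x = n j • w + ∑ i, (n i - n j) • t i := by
            have : ∑ i, (n i - n j) • t i = N • x - n j • ∑ i, t i := by
              rw [h, Finset.smul_sum, ← Finset.sum_sub_distrib]
              exact Finset.sum_congr rfl fun i _ => sub_nsmul' _ (hmin i (Finset.mem_univ i))
            rw [this, hw, smul_sub, sub_nsmul' _ (hlt j).le]
            abel
          rw [h1, ← Finset.add_sum_erase _ _ (Finset.mem_univ j),
            ← Finset.add_sum_erase Finset.univ _ (Finset.mem_univ j)]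
          simp only [if_true, Matrix.updateRow_self, Nat.sub_self, zero_smul, zero_add]
          congr 1
          refine Finset.sum_congr rfl fun i hi => ?_
          rw [Matrix.updateRow_ne (Finset.ne_of_mem_erase hi), if_neg (Finset.ne_of_mem_erase hi)]
          rfl
  obtain ⟨N, hN, hNx⟩ := hx
  obtain ⟨s, hsT, N, hN, n, h⟩ : ∃ s : Finset (κ → ℤ),
      (∀ t ∈ s, t ∈ T ∧ (deg t = 0 ∨ deg t = 1)) ∧
      ∃ N : ℕ, 1 ≤ N ∧ ∃ n : (κ → ℤ) → ℕ, N • x = ∑ t ∈ s, n t • t := by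
    obtain ⟨l, hl, hls⟩ := AddSubmonoid.exists_multiset_of_mem_closure (hT hNx)
    refine ⟨l.toFinset, fun t ht => hl t (Multiset.mem_toFinset.mp ht), N, hN,
      fun t => l.count t, ?_⟩
    rw [← hls, Finset.sum_multiset_count]
  obtain ⟨s, hss, hcard, N, hN, n, h⟩ := exists_nsmul_eq_sum_card_le x s ⟨N, hN, n, h⟩
  have hs' : ∀ t ∈ s, t ∈ saturation T ∧ (deg t = 0 ∨ deg t = 1) := fun t ht =>
    ⟨le_saturation T (hsT t (hss ht)).1, (hsT t (hss ht)).2⟩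
  rcases exists_sub_mem_or_mul_le deg s (fun t => t) hs' hN h with h1 | h1
  · exact hcon h1
  have hN' : (1 : ℤ) ≤ N := by exact_mod_cast hN
  have hd' : (1 : ℤ) ≤ d := by exact_mod_cast hd
  -- Since `deg x ≥ d`, more than `d` of the at most `d + 1` generators have degree 1; hence there
  -- are `d + 1` of them, all of degree 1.
  have hc : d < (s.filter fun t => deg t = 1).card := by
    by_contra hle
    push Not at hle
    have hle' : ((s.filter fun t => deg t = 1).card : ℤ) ≤ d := by exact_mod_cast hle
    nlinarith
  have hle := Finset.card_filter_le s fun t => deg t = 1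
  have hc' : s.card = Fintype.card κ := by omega
  have hall : ∀ t ∈ s, deg t = 1 :=
    Finset.filter_eq_self.mp (Finset.eq_of_subset_of_card_le (Finset.filter_subset _ _) (by omega))
  obtain ⟨eq⟩ : Nonempty (κ ≃ s) := ⟨Fintype.equivOfCardEq (by simp [hc'])⟩
  refine key _ (fun i => (eq i : κ → ℤ)) rfl
    (fun i => ⟨(hs' _ (eq i).2).1, hall _ (eq i).2⟩) ⟨N, hN, fun i => n (eq i), ?_⟩
  rw [h, ← Finset.sum_coe_sort s, ← Equiv.sum_comp eq]

end Saturation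

/-! ### Graded ideals of a subalgebra of `K[M]` -/

section GradedIdeal

variable {R K M : Type*} [CommRing R] [Field K] [Algebra R K] [AddCommGroup M]
variable {A : Subalgebra R (AddMonoidAlgebra K M)}

/-- The ideal `J` contains the homogeneous components of its elements. -/
def IsGradedIdeal (J : Ideal A) : Prop :=
  ∀ F ∈ J, ∀ m, ∃ G ∈ J, (G : AddMonoidAlgebra K M) =
    AddMonoidAlgebra.single m ((F : AddMonoidAlgebra K M).coeff m)

/-- A component of a product is a sum of products of components; `hA` says that the components of
the multipliers remain in `A`. -/
theorem isGradedIdeal_span {S : Set A} (hA : IsGradedIdeal (⊤ : Ideal A))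
    (hS : ∀ a ∈ S, ∃ (m : M) (f : K), (a : AddMonoidAlgebra K M) = AddMonoidAlgebra.single m f) :
    IsGradedIdeal (Ideal.span S) := by
  intro F hF
  induction hF using Submodule.span_induction with
  | mem x hx =>
    intro m
    obtain ⟨m', f, h⟩ := hS x hx
    by_cases hm : m = m'
    · exact ⟨x, Ideal.subset_span hx, by rw [h, hm, AddMonoidAlgebra.coeff_single,
        Finsupp.single_eq_same]⟩
    · exact ⟨0, zero_mem _, by rw [h, AddMonoidAlgebra.coeff_single,
        Finsupp.single_eq_of_ne hm, AddMonoidAlgebra.single_zero]; rfl⟩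
  | zero => exact fun m => ⟨0, zero_mem _, by simp⟩
  | add x y _ _ hx hy =>
    intro m
    obtain ⟨a, ha, ha'⟩ := hx m
    obtain ⟨b, hb, hb'⟩ := hy m
    refine ⟨a + b, add_mem ha hb, ?_⟩
    push_cast
    rw [ha', hb', AddMonoidAlgebra.coeff_add, Finsupp.add_apply, AddMonoidAlgebra.single_add]
  | smul r x _ hx =>
    intro m
    have hfin : ∀ m₁ m₂ : M, ∃ G ∈ Ideal.span S, (G : AddMonoidAlgebra K M) =
        AddMonoidAlgebra.single (m₁ + m₂) ((r : AddMonoidAlgebra K M).coeff m₁ *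
          (x : AddMonoidAlgebra K M).coeff m₂) := by
      intro m₁ m₂
      obtain ⟨a, -, ha⟩ := hA r trivial m₁
      obtain ⟨b, hb, hb'⟩ := hx m₂
      exact ⟨a * b, Ideal.mul_mem_left _ _ hb, by
        push_cast; rw [ha, hb', AddMonoidAlgebra.single_mul_single]⟩
    choose G hG hG' using hfin
    classical
    refine ⟨∑ m₁ ∈ (r : AddMonoidAlgebra K M).coeff.support,
      ∑ m₂ ∈ (x : AddMonoidAlgebra K M).coeff.support, if m₁ + m₂ = m then G m₁ m₂ else 0,
      sum_mem fun m₁ _ => sum_mem fun m₂ _ => by split_ifs; exacts [hG _ _, zero_mem _], ?_⟩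
    rw [smul_eq_mul]
    push_cast
    rw [AddMonoidAlgebra.coeff_mul, Finsupp.sum, ← AddMonoidAlgebra.singleAddHom_apply, map_sum]
    refine Finset.sum_congr rfl fun m₁ _ => ?_
    rw [Finsupp.sum, map_sum]
    refine Finset.sum_congr rfl fun m₂ _ => ?_
    rw [AddMonoidAlgebra.singleAddHom_apply]
    split_ifs with h
    · rw [hG', h]
    · simp

theorem IsGradedIdeal.isHomogeneous_span {J : Ideal A} (hJ : IsGradedIdeal J) :
    J = Ideal.span {a | a ∈ J ∧ ∃ (m : M) (f : K),
      (a : AddMonoidAlgebra K M) = AddMonoidAlgebra.single m f} := by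
  refine le_antisymm (fun F hF => ?_) (Ideal.span_le.mpr fun a ha => ha.1)
  choose G hG hG' using hJ F hF
  have : F = ∑ m ∈ (F : AddMonoidAlgebra K M).coeff.support, G m := by
    apply Subtype.ext
    push_cast
    rw [Finset.sum_congr rfl fun m _ => hG' m]
    exact (AddMonoidAlgebra.sum_coeff_single _).symm
  rw [this]
  exact sum_mem fun m _ => Ideal.subset_span ⟨hG m, m, _, hG' m⟩

theorem IsGradedIdeal.mul {I J : Ideal A} (hA : IsGradedIdeal (⊤ : Ideal A))
    (hI : IsGradedIdeal I) (hJ : IsGradedIdeal J) : IsGradedIdeal (I * J) := by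
  rw [hI.isHomogeneous_span, hJ.isHomogeneous_span, Ideal.span_mul_span']
  refine isGradedIdeal_span hA ?_
  rintro _ ⟨a, ⟨-, m, f, ha⟩, b, ⟨-, m', g, hb⟩, rfl⟩
  exact ⟨m + m', f * g, by push_cast; rw [ha, hb, AddMonoidAlgebra.single_mul_single]⟩

theorem IsGradedIdeal.pow {J : Ideal A} (hA : IsGradedIdeal (⊤ : Ideal A))
    (hJ : IsGradedIdeal J) (e : ℕ) : IsGradedIdeal (J ^ e) := by
  induction e with
  | zero => rwa [pow_zero, Ideal.one_eq_top]
  | succ e ih => rw [pow_succ]; exact IsGradedIdeal.mul hA ih hJ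

/-- A graded ideal is stable under the operators multiplying the component of degree `m` by
`r m`. -/
theorem IsGradedIdeal.exists_coeff_eq {J : Ideal A} (hJ : IsGradedIdeal J) (r : M → R) {F : A}
    (hF : F ∈ J) : ∃ G ∈ J, ∀ m, (G : AddMonoidAlgebra K M).coeff m =
      algebraMap R K (r m) * (F : AddMonoidAlgebra K M).coeff m := by
  classical
  choose G hG hG' using hJ F hF
  refine ⟨∑ m ∈ (F : AddMonoidAlgebra K M).coeff.support, algebraMap R A (r m) * G m,
    sum_mem fun m _ => Ideal.mul_mem_left _ _ (hG m), fun m => ?_⟩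
  push_cast
  rw [AddMonoidAlgebra.coeff_sum, Finsupp.finsetSum_apply]
  have : ∀ m' ∈ (F : AddMonoidAlgebra K M).coeff.support,
      ((algebraMap R (AddMonoidAlgebra K M) (r m') * (G m' : AddMonoidAlgebra K M)).coeff m)
      = if m' = m then algebraMap R K (r m) * (F : AddMonoidAlgebra K M).coeff m else 0 := by
    intro m' _
    rw [← Algebra.smul_def, AddMonoidAlgebra.coeff_smul_apply, hG', AddMonoidAlgebra.coeff_single,
      Finsupp.single_apply, Algebra.smul_def]
    split_ifs with h
    · rw [h]
    · simp
  rw [Finset.sum_congr rfl this, Finset.sum_ite_eq']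
  split_ifs with h
  · rfl
  · rw [Finsupp.notMem_support_iff.mp h, mul_zero]

theorem IsGradedIdeal.mem_of_forall {J : Ideal A} {F : A}
    (h : ∀ m, ∃ G ∈ J, (G : AddMonoidAlgebra K M) =
      AddMonoidAlgebra.single m ((F : AddMonoidAlgebra K M).coeff m)) : F ∈ J := by
  choose G hG hG' using h
  have : F = ∑ m ∈ (F : AddMonoidAlgebra K M).coeff.support, G m := by
    apply Subtype.ext
    push_cast
    rw [Finset.sum_congr rfl fun m _ => hG' m]
    exact (AddMonoidAlgebra.sum_coeff_single _).symm
  rw [this]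
  exact sum_mem fun m _ => hG m

end GradedIdeal

/-! ### The action of the torus -/

section Torus

variable {R K : Type*} [CommRing R] [Field K] [Algebra R K]

/-- The automorphism of `K[M]` multiplying `χ ^ m` by `χ m`. -/
def twist {M : Type*} [AddCommGroup M] (χ : Multiplicative M →* R) :
    AddMonoidAlgebra K M →+* AddMonoidAlgebra K M :=
  AddMonoidAlgebra.liftNCRingHom AddMonoidAlgebra.singleZeroRingHom
    ({ toFun := fun m => AddMonoidAlgebra.single m.toAdd (algebraMap R K (χ m))
       map_one' := by simp [AddMonoidAlgebra.one_def]
       map_mul' := fun a b => by simp [AddMonoidAlgebra.single_mul_single] } :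
      Multiplicative M →* AddMonoidAlgebra K M) (fun _ _ => mul_comm _ _)

theorem coeff_twist {M : Type*} [AddCommGroup M] (χ : Multiplicative M →* R)
    (F : AddMonoidAlgebra K M) (m : M) :
    (twist χ F).coeff m = algebraMap R K (χ (Multiplicative.ofAdd m)) * F.coeff m := by
  classical
  induction F using AddMonoidAlgebra.induction_linear with
  | zero => simp
  | add x y hx hy =>
    rw [map_add, AddMonoidAlgebra.coeff_add, Finsupp.add_apply, hx, hy, ← mul_add]; rfl
  | single m' f =>
    have : twist χ (AddMonoidAlgebra.single m' f) =
        AddMonoidAlgebra.single m' (f * algebraMap R K (χ (Multiplicative.ofAdd m'))) := by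
      refine (AddMonoidAlgebra.liftNC_single _ _ _ _).trans ?_
      simp [AddMonoidAlgebra.single_mul_single]
    rw [this, AddMonoidAlgebra.coeff_single, AddMonoidAlgebra.coeff_single, Finsupp.single_apply,
      Finsupp.single_apply]
    split_ifs with h
    · rw [h, mul_comm]
    · simp

/-- A torus element acts by a ring endomorphism preserving the graded ideals `J ^ i`, so it carries
an equation of integral dependence to another one. -/
theorem isGradedIdeal_idealClosure_aux {M : Type*} [AddCommGroup M]
    {A : Subalgebra R (AddMonoidAlgebra K M)} (hA : IsGradedIdeal (⊤ : Ideal A)) {J : Ideal A}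
    (hJ : IsGradedIdeal J) (χ : Multiplicative M →* R) {F : A} (hF : F ∈ idealClosure J) :
    ∃ G ∈ idealClosure J, ∀ m, (G : AddMonoidAlgebra K M).coeff m =
      algebraMap R K (χ (Multiplicative.ofAdd m)) * (F : AddMonoidAlgebra K M).coeff m := by
  have hst : ∀ e : ℕ, ∀ G ∈ J ^ e, ∃ H ∈ J ^ e,
      (H : AddMonoidAlgebra K M) = twist χ (G : AddMonoidAlgebra K M) := by
    intro e G hG
    obtain ⟨H, hH, hH'⟩ := (IsGradedIdeal.pow hA hJ e).exists_coeff_eq (fun m => χ (Multiplicative.ofAdd m)) hG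
    refine ⟨H, hH, ?_⟩
    ext m
    rw [hH', coeff_twist]
  -- The power of exponent 0 is the unit ideal: this only says that the twist of `F` lies in `A`.
  obtain ⟨G, -, hG⟩ := hst 0 F (by simp)
  refine ⟨G, ?_, fun m => by rw [hG, coeff_twist]⟩
  obtain ⟨r, hr, l, hl, h⟩ := hF
  have hl' : ∀ i : ℕ, ∃ l' : A, i ∈ Finset.Icc 1 r → l' ∈ J ^ i ∧
      (l' : AddMonoidAlgebra K M) = twist χ (l i : AddMonoidAlgebra K M) := by
    intro i
    by_cases hi : i ∈ Finset.Icc 1 r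
    · obtain ⟨H, hH⟩ := hst i (l i) (hl i hi)
      exact ⟨H, fun _ => hH⟩
    · exact ⟨0, fun h => absurd h hi⟩
  choose l' hl' using hl'
  refine ⟨r, hr, l', fun i hi => (hl' i hi).1, ?_⟩
  apply Subtype.ext
  have h2 := congrArg (fun a : A => twist χ (a : AddMonoidAlgebra K M)) h
  push_cast at h2 ⊢
  rw [map_add, map_pow, map_sum, map_zero] at h2
  rw [hG, ← h2]
  congr 1
  refine Finset.sum_congr rfl fun i hi => ?_
  rw [(hl' i hi).2, map_mul, map_pow]

variable {k : Type*} [Field k] [Algebra k R] {ι : Type*}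

/-- The character `m ↦ u ^ (m i)`. -/
def coordChar (u : kˣ) (i : ι) : Multiplicative (ι → ℤ) →* R where
  toFun m := algebraMap k R ((u ^ (m.toAdd i) : kˣ) : k)
  map_one' := by simp
  map_mul' a b := by simp [zpow_add]

/-- An ideal stable under the one-parameter subgroups of the torus is graded. -/
theorem isGradedIdeal_of_stable {A : Subalgebra R (AddMonoidAlgebra K (ι → ℤ))} {J : Ideal A}
    (u : kˣ) (hu : ∀ a b : ℤ, u ^ a = u ^ b → a = b)
    (hJ : ∀ i : ι, ∀ F ∈ J, ∃ G ∈ J, ∀ m, (G : AddMonoidAlgebra K (ι → ℤ)).coeff m =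
      algebraMap R K (algebraMap k R ((u ^ (m i) : kˣ) : k)) *
        (F : AddMonoidAlgebra K (ι → ℤ)).coeff m) : IsGradedIdeal J := by
  classical
  suffices H : ∀ s : Finset (ι → ℤ), ∀ F ∈ J, (F : AddMonoidAlgebra K (ι → ℤ)).coeff.support = s →
      ∀ m, ∃ G ∈ J, (G : AddMonoidAlgebra K (ι → ℤ)) =
        AddMonoidAlgebra.single m ((F : AddMonoidAlgebra K (ι → ℤ)).coeff m) from
    fun F hF => H _ F hF rfl
  intro s
  induction s using Finset.strongInduction with
  | H s ih =>
    intro F hF hs m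
    by_cases hm : (F : AddMonoidAlgebra K (ι → ℤ)).coeff m = 0
    · exact ⟨0, zero_mem _, by rw [hm]; simp⟩
    by_cases hone : ∀ m' ∈ s, m' = m
    · refine ⟨F, hF, ?_⟩
      ext m'
      rw [AddMonoidAlgebra.coeff_single, Finsupp.single_apply]
      split_ifs with h
      · rw [h]
      · by_contra hne
        exact h (hone m' (hs ▸ Finsupp.mem_support_iff.mpr hne)).symm
    push Not at hone
    obtain ⟨m', hm's, hm'⟩ := hone
    obtain ⟨i, hi⟩ := Function.ne_iff.mp hm'
    obtain ⟨G, hG, hG'⟩ := hJ i F hF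
    set c : k := ((u ^ (m' i) : kˣ) : k) with hc
    set d : k := ((u ^ (m i) : kˣ) : k) - c with hd
    have hd0 : d ≠ 0 := by
      rw [hd, sub_ne_zero, hc]
      intro h
      exact hi (hu _ _ (Units.ext h)).symm
    -- The component of degree `m'` is killed and that of degree `m` is multiplied by `d ≠ 0`, so
    -- the support shrinks and the component wanted is recovered by division.
    set G₁ : A := G - algebraMap R A (algebraMap k R c) * F with hG₁
    have hG₁J : G₁ ∈ J := sub_mem hG (Ideal.mul_mem_left _ _ hF)
    have hco : ∀ m'', (G₁ : AddMonoidAlgebra K (ι → ℤ)).coeff m'' =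
        algebraMap R K (algebraMap k R (((u ^ (m'' i) : kˣ) : k) - c)) *
          (F : AddMonoidAlgebra K (ι → ℤ)).coeff m'' := by
      intro m''
      rw [show (G₁ : AddMonoidAlgebra K (ι → ℤ)) = (G : AddMonoidAlgebra K (ι → ℤ)) -
        algebraMap R (AddMonoidAlgebra K (ι → ℤ)) (algebraMap k R c) * F from rfl]
      rw [AddMonoidAlgebra.coeff_sub, Finsupp.sub_apply, hG',
        ← Algebra.smul_def (algebraMap k R c) (F : AddMonoidAlgebra K (ι → ℤ)), AddMonoidAlgebra.coeff_smul_apply, Algebra.smul_def, map_sub, map_sub, sub_mul]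
    obtain ⟨H, hH, hH'⟩ := ih (G₁ : AddMonoidAlgebra K (ι → ℤ)).coeff.support (by
      refine Finset.ssubset_iff_subset_ne.mpr ⟨fun m'' h => ?_, fun h => ?_⟩
      · rw [← hs, Finsupp.mem_support_iff]
        rw [Finsupp.mem_support_iff, hco] at h
        exact right_ne_zero_of_mul h
      · rw [← h, Finsupp.mem_support_iff, hco, hc, sub_self, map_zero, map_zero, zero_mul] at hm's
        exact hm's rfl) G₁ hG₁J rfl m
    refine ⟨algebraMap R A (algebraMap k R d⁻¹) * H, Ideal.mul_mem_left _ _ hH, ?_⟩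
    push_cast
    rw [hH', hco, ← Algebra.smul_def, AddMonoidAlgebra.smul_single, Algebra.smul_def, ← mul_assoc,
      ← map_mul, ← map_mul, ← hd, inv_mul_cancel₀ hd0, map_one, map_one, one_mul]

theorem two_zpow_injective [CharZero k] (a b : ℤ)
    (h : (Units.mk0 (2 : k) two_ne_zero) ^ a = (Units.mk0 (2 : k) two_ne_zero) ^ b) : a = b := by
  have h1 := congrArg (Units.val) h
  rw [Units.val_zpow_eq_zpow_val, Units.val_zpow_eq_zpow_val, Units.val_mk0] at h1
  have h2 : ((2 : ℚ) ^ a : ℚ) = 2 ^ b := by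
    have : (((2 : ℚ) ^ a : ℚ) : k) = ((2 ^ b : ℚ) : k) := by push_cast; exact h1
    exact_mod_cast this
  exact zpow_right_injective₀ (by norm_num) (by norm_num) h2

/-- One element of infinite order in each coordinate subgroup of the torus separates the degrees; in
characteristic zero, `2` serves. -/
theorem IsGradedIdeal.idealClosure (k : Type*) [Field k] [CharZero k] [Algebra k R]
    {A : Subalgebra R (AddMonoidAlgebra K (ι → ℤ))}
    (hA : IsGradedIdeal (⊤ : Ideal A)) {J : Ideal A} (hJ : IsGradedIdeal J) :
    IsGradedIdeal (idealClosure J) :=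
  isGradedIdeal_of_stable (Units.mk0 (2 : k) two_ne_zero) two_zpow_injective fun i _ hF =>
    isGradedIdeal_idealClosure_aux hA hJ (coordChar (Units.mk0 (2 : k) two_ne_zero) i) hF

end Torus

/-! ### Orders of the elements of a graded ideal at a point of the curve -/

section Orders

open IsDedekindDomain

variable {R K M : Type*} [CommRing R] [IsDedekindDomain R] [Field K] [Algebra R K]
  [IsFractionRing R K] [AddCommGroup M]
variable {A : Subalgebra R (AddMonoidAlgebra K M)}

/-- The pairs `(m, c)` such that some element of `J` has a component of degree `m` and of order
at most `c` at `z`. -/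
def orders (z : HeightOneSpectrum R) (J : Ideal A) : Set (M × ℤ) :=
  {x | ∃ F ∈ J, WithZero.exp (-x.2) ≤ z.valuation K ((F : AddMonoidAlgebra K M).coeff x.1)}

theorem exists_valuation_eq_exp (z : HeightOneSpectrum R) {f : K} (hf : f ≠ 0) :
    ∃ c : ℤ, z.valuation K f = WithZero.exp (-c) :=
  ⟨-(z.valuation K f).log, by
    rw [neg_neg, WithZero.exp_log ((Valuation.ne_zero_iff _).mpr hf)]⟩

theorem orders_of_le {z : HeightOneSpectrum R} {J : Ideal A} {m : M} {c c' : ℤ} (h : c ≤ c')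
    (hx : (m, c) ∈ orders z J) : (m, c') ∈ orders z J := by
  obtain ⟨F, hF, hx⟩ := hx
  refine ⟨F, hF, le_trans ?_ hx⟩
  rw [WithZero.exp_le_exp]
  simpa using h

theorem zero_mem_orders (z : HeightOneSpectrum R) : (0 : M × ℤ) ∈ orders z (⊤ : Ideal A) :=
  ⟨1, trivial, by simp [AddMonoidAlgebra.one_def]⟩

/-- By the ultrametric inequality, some product of components contributing to the coefficient
already has order at most the given bound. No grading is needed in this direction. -/
theorem exists_add_eq_of_mem_orders_mul {z : HeightOneSpectrum R} {I J : Ideal A} {x : M × ℤ}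
    (hx : x ∈ orders z (I * J)) : ∃ a ∈ orders z I, ∃ b ∈ orders z J, a + b = x := by
  classical
  obtain ⟨F, hF, hx⟩ := hx
  revert hx
  refine Submodule.mul_induction_on hF (fun a ha b hb hx => ?_) fun F G hF hG hx => ?_
  swap
  · push_cast at hx
    rw [AddMonoidAlgebra.coeff_add, Finsupp.add_apply] at hx
    rcases le_max_iff.mp (hx.trans (Valuation.map_add _ _ _)) with h | h
    exacts [hF h, hG h]
  · by_contra hcon
    refine absurd hx (not_le.mpr ?_)
    push_cast
    rw [AddMonoidAlgebra.coeff_mul]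
    refine Valuation.map_sum_lt _ WithZero.exp_ne_zero fun m₁ _ =>
      Valuation.map_sum_lt _ WithZero.exp_ne_zero fun m₂ _ => ?_
    dsimp only
    split_ifs with h
    swap
    · rw [map_zero]; exact WithZero.exp_pos
    by_contra hle
    rw [not_lt, map_mul] at hle
    have h0 : (a : AddMonoidAlgebra K M).coeff m₁ ≠ 0 := by
      intro h0
      rw [h0, map_zero, zero_mul] at hle
      exact absurd hle (not_le.mpr WithZero.exp_pos)
    obtain ⟨c, hc⟩ := exists_valuation_eq_exp z h0
    -- The first factor receives its exact order, the second one all the slack.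
    refine hcon ⟨(m₁, c), ⟨a, ha, hc.ge⟩, (m₂, x.2 - c), ⟨b, hb, ?_⟩, Prod.ext h (by simp)⟩
    rw [hc] at hle
    rw [show (-x.2 : ℤ) = -c + (-(x.2 - c)) by ring, WithZero.exp_add] at hle
    exact le_of_mul_le_mul_left hle WithZero.exp_pos

/-- Gradedness allows one to multiply single components, so that no cancellation occurs. -/
theorem add_mem_orders_mul {z : HeightOneSpectrum R} {I J : Ideal A} (hI : IsGradedIdeal I)
    (hJ : IsGradedIdeal J) {a b : M × ℤ} (ha : a ∈ orders z I) (hb : b ∈ orders z J) :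
    a + b ∈ orders z (I * J) := by
  obtain ⟨F, hF, ha⟩ := ha
  obtain ⟨G, hG, hb⟩ := hb
  obtain ⟨F', hF', h1⟩ := hI F hF a.1
  obtain ⟨G', hG', h2⟩ := hJ G hG b.1
  refine ⟨F' * G', Ideal.mul_mem_mul hF' hG', ?_⟩
  push_cast
  rw [h1, h2, AddMonoidAlgebra.single_mul_single, AddMonoidAlgebra.coeff_single, Prod.fst_add,
    Finsupp.single_eq_same, map_mul, Prod.snd_add, neg_add, WithZero.exp_add]
  exact mul_le_mul' ha hb

theorem nsmul_mem_orders_pow {z : HeightOneSpectrum R} (hA : IsGradedIdeal (⊤ : Ideal A))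
    {J : Ideal A} (hJ : IsGradedIdeal J) {x : M × ℤ} (hx : x ∈ orders z J) (s : ℕ) :
    s • x ∈ orders z (J ^ s) := by
  induction s with
  | zero => rw [zero_smul, pow_zero, Ideal.one_eq_top]; exact zero_mem_orders z
  | succ s ih =>
    rw [succ_nsmul, pow_succ]
    exact add_mem_orders_mul (IsGradedIdeal.pow hA hJ s) hJ ih hx

theorem sum_mem_orders_pow {z : HeightOneSpectrum R} (hA : IsGradedIdeal (⊤ : Ideal A))
    {J : Ideal A} (hJ : IsGradedIdeal J) {s : ℕ} {f : Fin s → M × ℤ}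
    (hf : ∀ j, f j ∈ orders z J) : ∑ j, f j ∈ orders z (J ^ s) := by
  induction s with
  | zero =>
    rw [Fin.sum_univ_zero, pow_zero, Ideal.one_eq_top]; exact zero_mem_orders z
  | succ s ih =>
    rw [Fin.sum_univ_castSucc, pow_succ]
    exact add_mem_orders_mul (IsGradedIdeal.pow hA hJ s) hJ (ih fun j => hf _) (hf _)

theorem exists_sum_eq_of_mem_orders_pow {z : HeightOneSpectrum R} {J : Ideal A} {s : ℕ}
    (hs : 1 ≤ s) {x : M × ℤ} (hx : x ∈ orders z (J ^ s)) :
    ∃ f : Fin s → M × ℤ, (∀ j, f j ∈ orders z J) ∧ ∑ j, f j = x := by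
  induction s, hs using Nat.le_induction generalizing x with
  | base => exact ⟨fun _ => x, fun _ => by simpa using hx, by simp⟩
  | succ s hs ih =>
    rw [pow_succ] at hx
    obtain ⟨a, ha, b, hb, rfl⟩ := exists_add_eq_of_mem_orders_mul hx
    obtain ⟨f, hf, rfl⟩ := ih ha
    refine ⟨Fin.snoc f b, fun j => ?_, by rw [Fin.sum_univ_castSucc]; simp⟩
    refine Fin.lastCases ?_ (fun j => ?_) j
    · rw [Fin.snoc_last]; exact hb
    · rw [Fin.snoc_castSucc]; exact hf j

/-- A homogeneous element belongs to a graded ideal as soon as it does so locally on the curve. -/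
theorem mem_of_forall_mem_orders (hR : ¬ IsField R) {J : Ideal A} (hJ : IsGradedIdeal J) {G : A}
    {m : M} {f : K} (hG : (G : AddMonoidAlgebra K M) = AddMonoidAlgebra.single m f)
    (h : ∀ (z : HeightOneSpectrum R) (c : ℤ), z.valuation K f = WithZero.exp (-c) →
      (m, c) ∈ orders z J) : G ∈ J := by
  by_cases hf : f = 0
  · have : G = 0 := Subtype.ext (by rw [hG, hf]; simp)
    rw [this]; exact zero_mem _
  -- The ideal of the `r` with `r • G ∈ J`. If it were proper it would lie in the ideal of a point
  -- `z`, whereas the hypothesis at `z` yields an element of it not vanishing there.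
  let S : Ideal R := (Submodule.restrictScalars R J).comap (LinearMap.toSpanSingleton R A G)
  have hS : ∀ r, r ∈ S ↔ r • G ∈ J := fun r => Iff.rfl
  suffices hT : S = ⊤ by
    have := (hS 1).mp (hT ▸ trivial)
    rwa [one_smul] at this
  by_contra hne
  obtain ⟨p, hp, hSp⟩ := Ideal.exists_le_maximal S hne
  let z : HeightOneSpectrum R := ⟨p, hp.isPrime, Ring.ne_bot_of_isMaximal_of_not_isField hp hR⟩
  obtain ⟨c, hc⟩ := exists_valuation_eq_exp z hf
  obtain ⟨F, hF, hle⟩ := h z c hc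
  rw [← hc] at hle
  dsimp only at hle
  obtain ⟨G', hG', hG'eq⟩ := hJ F hF m
  set g := (F : AddMonoidAlgebra K M).coeff m with hg
  have hg0 : g ≠ 0 := by
    intro h0
    rw [h0, map_zero, le_zero_iff, Valuation.zero_iff] at hle
    exact hf hle
  have hv : z.valuation K (f / g) ≤ 1 := by
    rw [map_div₀]
    exact div_le_one_of_le₀ hle zero_le
  obtain ⟨n, d, hnd⟩ := z.exists_primeCompl_mul_eq_of_integer (f / g) hv
  refine d.2 (hSp ((hS d).mpr ?_))
  have : (d : R) • G = n • G' := by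
    apply Subtype.ext
    rw [Subalgebra.coe_smul, Subalgebra.coe_smul, hG, hG'eq, AddMonoidAlgebra.smul_single,
      AddMonoidAlgebra.smul_single, Algebra.smul_def, Algebra.smul_def, ← hnd]
    congr 1
    field_simp
  rw [this]
  exact (Submodule.restrictScalars R J).smul_mem n hG'

/-- The orders of an element integral over a graded ideal. -/
theorem exists_nsmul_mem_orders_pow {J : Ideal A} (hJc : IsGradedIdeal (idealClosure J))
    {z : HeightOneSpectrum R} {x : M × ℤ} (hx : x ∈ orders z (idealClosure J)) :
    ∃ N : ℕ, 1 ≤ N ∧ N • x ∈ orders z (J ^ N) := by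
  obtain ⟨m, c⟩ := x
  obtain ⟨F, hF, hle⟩ := hx
  obtain ⟨G, hG, hGF⟩ := hJc F hF m
  set f := (F : AddMonoidAlgebra K M).coeff m
  dsimp only at hle
  obtain ⟨r, hr, l, hl, h⟩ := hG
  have h1 := congrArg (fun a : A => (a : AddMonoidAlgebra K M).coeff (r • m)) h
  push_cast at h1
  rw [hGF, AddMonoidAlgebra.single_pow, AddMonoidAlgebra.coeff_add, Finsupp.add_apply,
    AddMonoidAlgebra.coeff_single, Finsupp.single_eq_same, AddMonoidAlgebra.coeff_sum,
    Finsupp.finsetSum_apply, AddMonoidAlgebra.coeff_zero, Finsupp.zero_apply] at h1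
  have h2 : ∀ i ∈ Finset.Icc 1 r, ((l i : AddMonoidAlgebra K M) *
      AddMonoidAlgebra.single m f ^ (r - i)).coeff (r • m)
      = (l i : AddMonoidAlgebra K M).coeff (i • m) * f ^ (r - i) := by
    intro i hi
    have hir := (Finset.mem_Icc.mp hi).2
    rw [AddMonoidAlgebra.single_pow, AddMonoidAlgebra.coeff_mul_single_apply]
    congr 2
    rw [← sub_eq_add_neg, sub_eq_iff_eq_add, ← add_nsmul]
    congr 1
    omega
  rw [Finset.sum_congr rfl h2] at h1
  have hf : f ≠ 0 := by
    intro h0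
    rw [h0, map_zero] at hle
    exact absurd hle (not_le.mpr WithZero.exp_pos)
  -- In the component of degree `r • m` of the integral equation, some term must have valuation at
  -- least that of `f ^ r`; its index `i` is the `N` sought.
  by_contra hcon
  push Not at hcon
  have h3 : z.valuation K (∑ i ∈ Finset.Icc 1 r,
      (l i : AddMonoidAlgebra K M).coeff (i • m) * f ^ (r - i)) < z.valuation K (f ^ r) := by
    refine Valuation.map_sum_lt _ ((Valuation.ne_zero_iff _).mpr (pow_ne_zero _ hf)) fun i hi => ?_
    obtain ⟨hi1, hir⟩ := Finset.mem_Icc.mp hi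
    have h4 := hcon i hi1
    have h5 : z.valuation K ((l i : AddMonoidAlgebra K M).coeff (i • m)) < z.valuation K (f ^ i) := by
      by_contra hge
      rw [not_lt] at hge
      refine h4 ⟨l i, hl i hi, le_trans ?_ hge⟩
      rw [map_pow, Prod.smul_snd, ← smul_neg, WithZero.exp_nsmul]
      exact pow_le_pow_left₀ zero_le hle i
    rw [map_mul, show f ^ r = f ^ i * f ^ (r - i) by rw [← pow_add]; congr 1; omega, map_mul]
    exact mul_lt_mul_of_pos_right h5
      (zero_lt_iff.mpr ((Valuation.ne_zero_iff _).mpr (pow_ne_zero _ hf)))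
  rw [add_eq_zero_iff_eq_neg] at h1
  rw [h1, Valuation.map_neg] at h3
  exact lt_irrefl _ h3

/-- The subalgebra `A` of `K[M]` contains the monomials having a positive power in `A`. -/
def IsRootClosed (A : Subalgebra R (AddMonoidAlgebra K M)) : Prop :=
  ∀ (N : ℕ) (m : M) (f : K), 1 ≤ N → AddMonoidAlgebra.single (N • m) (f ^ N) ∈ A →
    AddMonoidAlgebra.single m f ∈ A

/-- Take `u` of order exactly `c` at `z` and clear the denominators of `u ^ N / g` by some `d` prime
to `z`: the `N`-th power of the monomial with coefficient `d * u` lies in `J ^ N`. Root closedness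
puts the monomial itself in `A`, and it is then integral over `J`. -/
theorem mem_orders_idealClosure (hroot : IsRootClosed A) {J : Ideal A}
    (hA : IsGradedIdeal (⊤ : Ideal A)) (hJ : IsGradedIdeal J) {z : HeightOneSpectrum R}
    {x : M × ℤ} {N : ℕ} (hN : 1 ≤ N) (hx : N • x ∈ orders z (J ^ N)) :
    x ∈ orders z (idealClosure J) := by
  obtain ⟨m, c⟩ := x
  obtain ⟨F, hF, hle⟩ := hx
  obtain ⟨G, hG, hGF⟩ := IsGradedIdeal.pow hA hJ N F hF (N • m)
  simp only [Prod.smul_mk] at hle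
  set g := (F : AddMonoidAlgebra K M).coeff (N • m)
  have hg : g ≠ 0 := by
    intro h0
    rw [h0, map_zero] at hle
    exact absurd hle (not_le.mpr WithZero.exp_pos)
  obtain ⟨u, hu⟩ := z.valuation_surjective K (WithZero.exp (-c))
  have hv : z.valuation K (u ^ N / g) ≤ 1 := by
    rw [map_div₀, map_pow, hu, ← WithZero.exp_nsmul, smul_neg]
    exact div_le_one_of_le₀ hle zero_le
  obtain ⟨n, d, hnd⟩ := z.exists_primeCompl_mul_eq_of_integer _ hv
  have hd1 : z.valuation K (algebraMap R K d) = 1 :=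
    (z.valuation_eq_one_iff_notMem).mpr d.2
  set f : K := algebraMap R K d * u with hf
  have hfN : f ^ N = algebraMap R K (d ^ (N - 1) * n) * g := by
    rw [hf, map_mul, ← hnd, map_pow, mul_pow]
    obtain ⟨N, rfl⟩ := Nat.exists_eq_add_of_le' hN
    simp only [Nat.add_sub_cancel]
    field_simp
    ring
  have hmem : ((d : R) ^ (N - 1) * n) • G ∈ J ^ N :=
    (Submodule.restrictScalars R (J ^ N)).smul_mem _ hG
  have hcoe : ((((d : R) ^ (N - 1) * n) • G : A) : AddMonoidAlgebra K M) =
      AddMonoidAlgebra.single (N • m) (f ^ N) := by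
    rw [Subalgebra.coe_smul, hGF, AddMonoidAlgebra.smul_single, Algebra.smul_def, ← hfN]
  have hfA : AddMonoidAlgebra.single m f ∈ A := hroot N m f hN (hcoe ▸ Subtype.property _)
  -- The equation is `a ^ N - b = 0` with `b ∈ J ^ N`; only its last coefficient is nonzero.
  refine ⟨⟨_, hfA⟩, ⟨N, hN, fun i => if i = N then - ((d : R) ^ (N - 1) * n) • G else 0,
    fun i _ => ?_, ?_⟩, ?_⟩
  · dsimp only
    split_ifs with h
    · rw [h, neg_smul]; exact neg_mem hmem
    · exact zero_mem _
  · rw [Finset.sum_eq_single_of_mem N (Finset.mem_Icc.mpr ⟨hN, le_rfl⟩)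
      fun i _ h => by dsimp only; rw [if_neg h, zero_mul]]
    dsimp only
    rw [if_pos rfl, Nat.sub_self, pow_zero, mul_one, neg_smul, ← sub_eq_add_neg, sub_eq_zero]
    apply Subtype.ext
    rw [hcoe]
    push_cast
    rw [AddMonoidAlgebra.single_pow]
  · rw [AddMonoidAlgebra.coeff_single, Finsupp.single_eq_same, hf, map_mul, hd1, one_mul, hu]

/-- A criterion of normality in terms of orders. -/
theorem isNormalIdeal_of_orders (hR : ¬ IsField R) (hA : IsGradedIdeal (⊤ : Ideal A)) {J : Ideal A}
    (hJ : IsGradedIdeal J) (hcl : ∀ s : ℕ, IsGradedIdeal (idealClosure (J ^ s)))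
    (h : ∀ (z : HeightOneSpectrum R) (s : ℕ), 1 ≤ s → ∀ x : M × ℤ,
      (∃ N : ℕ, 1 ≤ N ∧ N • x ∈ orders z (J ^ (N * s))) → x ∈ orders z (J ^ s)) :
    IsNormalIdeal J := by
  intro s hs F hF
  refine IsGradedIdeal.mem_of_forall fun m => ?_
  obtain ⟨G, hG, hGF⟩ := hcl s F hF m
  refine ⟨G, mem_of_forall_mem_orders hR (IsGradedIdeal.pow hA hJ s) hGF fun z c hc => ?_, hGF⟩
  refine h z s hs _ ?_
  obtain ⟨N, hN, hx⟩ := exists_nsmul_mem_orders_pow (hcl s)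
    (x := (m, c)) (z := z) ⟨F, hF, hc.ge⟩
  exact ⟨N, hN, by rwa [← pow_mul, mul_comm] at hx⟩

end Orders

/-! ### Normality of the integral closures of large powers -/

section LargePowers

open IsDedekindDomain

variable {R K : Type*} [CommRing R] [IsDedekindDomain R] [Field K] [Algebra R K]
  [IsFractionRing R K]

/-- The pairs `x` having a positive multiple `N • x` among the orders of `I ^ (N * e)`. -/
def satOrders {M : Type*} [AddCommGroup M] {A : Subalgebra R (AddMonoidAlgebra K M)}
    (z : HeightOneSpectrum R) (I : Ideal A) (e : ℕ) : Set (M × ℤ) :=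
  {x | ∃ N : ℕ, 1 ≤ N ∧ N • x ∈ orders z (I ^ (N * e))}

section SatOrders

variable {M : Type*} [AddCommGroup M] {A : Subalgebra R (AddMonoidAlgebra K M)}
  {z : HeightOneSpectrum R} {I : Ideal A}

theorem satOrders_of_nsmul {x : M × ℤ} {N e : ℕ} (hN : 1 ≤ N)
    (hx : N • x ∈ satOrders z I (N * e)) : x ∈ satOrders z I e := by
  obtain ⟨N', hN', h⟩ := hx
  exact ⟨N' * N, Nat.mul_pos hN' hN, by rwa [mul_smul, mul_assoc]⟩

theorem add_mem_satOrders (hA : IsGradedIdeal (⊤ : Ideal A)) (hI : IsGradedIdeal I)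
    {x y : M × ℤ} {a b : ℕ} (hx : x ∈ satOrders z I a) (hy : y ∈ satOrders z I b) :
    x + y ∈ satOrders z I (a + b) := by
  obtain ⟨N, hN, hx⟩ := hx
  obtain ⟨N', hN', hy⟩ := hy
  refine ⟨N * N', Nat.mul_pos hN hN', ?_⟩
  have h1 := nsmul_mem_orders_pow hA (IsGradedIdeal.pow hA hI _) hx N'
  have h2 := nsmul_mem_orders_pow hA (IsGradedIdeal.pow hA hI _) hy N
  have h3 := add_mem_orders_mul (IsGradedIdeal.pow hA (IsGradedIdeal.pow hA hI _) _)
    (IsGradedIdeal.pow hA (IsGradedIdeal.pow hA hI _) _) h1 h2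
  rw [← pow_mul, ← pow_mul, ← pow_add, ← mul_smul, ← mul_smul, mul_comm N' N, ← smul_add] at h3
  rwa [show N * N' * (a + b) = N * a * N' + N' * b * N by ring]

theorem orders_idealClosure_pow (hA : IsGradedIdeal (⊤ : Ideal A)) (hroot : IsRootClosed A)
    (hI : IsGradedIdeal I) {e : ℕ} (hc : IsGradedIdeal (idealClosure (I ^ e))) :
    orders z (idealClosure (I ^ e)) = satOrders z I e := by
  ext x
  constructor
  · intro hx
    obtain ⟨N, hN, h⟩ := exists_nsmul_mem_orders_pow hc hx
    exact ⟨N, hN, by rwa [← pow_mul, mul_comm] at h⟩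
  · rintro ⟨N, hN, h⟩
    rw [mul_comm, pow_mul] at h
    exact mem_orders_idealClosure hroot hA (IsGradedIdeal.pow hA hI e) hN h

end SatOrders

variable {ι : Type*} {A : Subalgebra R (AddMonoidAlgebra K (ι → ℤ))}
  {z : HeightOneSpectrum R} {I : Ideal A}

/-- The monoid of the monomials of the Rees algebra of `I` at `z`. -/
def reesMonoid (hA : IsGradedIdeal (⊤ : Ideal A)) (hI : IsGradedIdeal I)
    (z : HeightOneSpectrum R) : AddSubmonoid ((ι ⊕ Unit) ⊕ Unit → ℤ) where
  carrier := {v | ∃ e : ℕ, v (Sum.inr ()) = e ∧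
    ((fun i => v (Sum.inl (Sum.inl i)), v (Sum.inl (Sum.inr ()))) : (ι → ℤ) × ℤ) ∈
      orders z (I ^ e)}
  zero_mem' := ⟨0, by simp, by rw [pow_zero, Ideal.one_eq_top]; exact zero_mem_orders z⟩
  add_mem' := by
    rintro v w ⟨a, ha, hv⟩ ⟨b, hb, hw⟩
    refine ⟨a + b, by simp [ha, hb], ?_⟩
    rw [pow_add]
    exact add_mem_orders_mul (IsGradedIdeal.pow hA hI a) (IsGradedIdeal.pow hA hI b) hv hw

theorem extend_mem_reesMonoid {hA : IsGradedIdeal (⊤ : Ideal A)} {hI : IsGradedIdeal I}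
    {x : (ι → ℤ) × ℤ} {e : ℕ} :
    extend (extend x.1 x.2) (e : ℤ) ∈ reesMonoid hA hI z ↔ x ∈ orders z (I ^ e) := by
  constructor
  · rintro ⟨e', he', h⟩
    have : e = e' := by simpa [extend] using he'
    subst this
    exact h
  · exact fun h => ⟨e, rfl, h⟩

theorem extend_mem_saturation {hA : IsGradedIdeal (⊤ : Ideal A)} {hI : IsGradedIdeal I}
    {x : (ι → ℤ) × ℤ} {e : ℕ} :
    extend (extend x.1 x.2) (e : ℤ) ∈ saturation (reesMonoid hA hI z) ↔ x ∈ satOrders z I e := by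
  rw [mem_saturation]
  refine exists_congr fun N => and_congr_right fun _ => ?_
  rw [← extend_mem_reesMonoid (hA := hA) (hI := hI)]
  have : N • extend (extend x.1 x.2) (e : ℤ) =
      extend (extend (N • x).1 (N • x).2) ((N * e : ℕ) : ℤ) := by
    ext i
    rcases i with (i | i) | i <;> simp [extend]
  rw [this]

/-- Each factor of `I ^ (e + 1) = I ^ e * I` accounts for one generator of degree 1; degree 0 is
given by the orders of `A` itself. -/
theorem reesMonoid_le (hA : IsGradedIdeal (⊤ : Ideal A)) (hI : IsGradedIdeal I) :
    reesMonoid hA hI z ≤ AddSubmonoid.closure {t | t ∈ reesMonoid hA hI z ∧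
      (Pi.evalAddMonoidHom (fun _ => ℤ) (Sum.inr ()) t = 0 ∨
        Pi.evalAddMonoidHom (fun _ => ℤ) (Sum.inr ()) t = 1)} := by
  have key : ∀ (e : ℕ) (x : (ι → ℤ) × ℤ), x ∈ orders z (I ^ e) →
      extend (extend x.1 x.2) (e : ℤ) ∈ AddSubmonoid.closure {t | t ∈ reesMonoid hA hI z ∧
      (Pi.evalAddMonoidHom (fun _ => ℤ) (Sum.inr ()) t = 0 ∨
        Pi.evalAddMonoidHom (fun _ => ℤ) (Sum.inr ()) t = 1)} := by
    intro e
    induction e with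
    | zero =>
      intro x hx
      exact AddSubmonoid.subset_closure ⟨extend_mem_reesMonoid.mpr hx, Or.inl (by simp [extend])⟩
    | succ e ih =>
      intro x hx
      rw [pow_succ] at hx
      obtain ⟨a, ha, b, hb, rfl⟩ := exists_add_eq_of_mem_orders_mul hx
      have : extend (extend (a + b).1 (a + b).2) ((e + 1 : ℕ) : ℤ) =
          extend (extend a.1 a.2) (e : ℤ) + extend (extend b.1 b.2) ((1 : ℕ) : ℤ) := by
        ext i
        rcases i with (i | i) | i <;> simp [extend]
      rw [this]
      refine add_mem (ih a ha) (AddSubmonoid.subset_closure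
        ⟨extend_mem_reesMonoid.mpr (by rwa [pow_one]), Or.inr (by simp [extend])⟩)
  rintro v ⟨e, he, hv⟩
  have h := key e _ hv
  convert h using 1
  ext i
  rcases i with (i | i) | i <;> simp [extend, ← he]

/-- The origin of the bound `e ≥ n`: the lattice has rank `n + 2`, namely `n` for the degree, one
for the order and one for the exponent. So `d = n + 1` in the combinatorial lemma, and `e + 1 ≥ d`
is what it needs. -/
theorem exists_satOrders_one_sub_mem [Fintype ι] (hA : IsGradedIdeal (⊤ : Ideal A)) (hI : IsGradedIdeal I)
    {e : ℕ} (he : Fintype.card ι ≤ e) {x : (ι → ℤ) × ℤ} (hx : x ∈ satOrders z I (e + 1)) :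
    ∃ y ∈ satOrders z I 1, x - y ∈ satOrders z I e := by
  obtain ⟨v, hv, hv1, hxv⟩ := exists_degree_one_sub_mem (reesMonoid hA hI z)
    (Pi.evalAddMonoidHom (fun _ => ℤ) (Sum.inr ())) (reesMonoid_le hA hI)
    (d := Fintype.card ι + 1) (by omega) (by simp)
    (extend_mem_saturation.mpr hx) (by simpa [extend] using he)
  rw [Pi.evalAddMonoidHom_apply] at hv1
  refine ⟨(fun i => v (Sum.inl (Sum.inl i)), v (Sum.inl (Sum.inr ()))), ?_, ?_⟩
  · rw [← extend_mem_saturation (hA := hA) (hI := hI)]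
    convert hv using 1
    ext i
    rcases i with (i | i) | i <;> simp [extend, hv1]
  · rw [← extend_mem_saturation (hA := hA) (hI := hI)]
    convert hxv using 1
    ext i
    rcases i with (i | i) | i <;> simp [extend, hv1]

theorem exists_satOrders_sub_mem [Fintype ι] (hA : IsGradedIdeal (⊤ : Ideal A)) (hI : IsGradedIdeal I)
    {e : ℕ} (he : Fintype.card ι ≤ e) (j : ℕ) {x : (ι → ℤ) × ℤ}
    (hx : x ∈ satOrders z I (e + j)) :
    ∃ y ∈ satOrders z I j, x - y ∈ satOrders z I e := by
  induction j generalizing x with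
  | zero =>
    refine ⟨0, ⟨1, le_rfl, ?_⟩, by simpa using hx⟩
    rw [mul_zero, pow_zero, Ideal.one_eq_top, smul_zero]
    exact zero_mem_orders z
  | succ j ih =>
    obtain ⟨y, hy, hxy⟩ := exists_satOrders_one_sub_mem hA hI (e := e + j) (by omega) hx
    obtain ⟨y', hy', h⟩ := ih hxy
    exact ⟨y' + y, add_mem_satOrders hA hI hy' hy, by rwa [← sub_sub, sub_right_comm]⟩

/-- The integral closures of the powers `I ^ e`, `e ≥ n`, of a graded ideal of a root closed
subalgebra of `K[ℤ ^ n]` are normal. -/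
theorem isNormalIdeal_idealClosure_pow [Fintype ι] (k : Type*) [Field k] [CharZero k] [Algebra k R]
    (hR : ¬ IsField R) (hA : IsGradedIdeal (⊤ : Ideal A)) (hroot : IsRootClosed A)
    (hI : IsGradedIdeal I) {e : ℕ} (he : Fintype.card ι ≤ e) :
    IsNormalIdeal (idealClosure (I ^ e)) := by
  have hJ := IsGradedIdeal.idealClosure k hA (IsGradedIdeal.pow hA hI e)
  have horders := fun z => orders_idealClosure_pow (z := z) hA hroot hI hJ
  have hsub : ∀ (z : HeightOneSpectrum R) (t : ℕ),
      orders z (idealClosure (I ^ e) ^ t) ⊆ satOrders z I (t * e) := by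
    intro z t
    induction t with
    | zero =>
      intro x hx
      exact ⟨1, le_rfl, by simpa using hx⟩
    | succ t ih =>
      intro x hx
      rw [pow_succ] at hx
      obtain ⟨a, ha, b, hb, rfl⟩ := exists_add_eq_of_mem_orders_mul hx
      rw [horders] at hb
      rw [add_mul, one_mul]
      exact add_mem_satOrders hA hI (ih ha) hb
  -- Blocks of exponent `e` are split off one at a time; for `s ≥ 1` the remaining exponent `s * e`
  -- is still at least `n`.
  have hsup : ∀ (z : HeightOneSpectrum R) (s : ℕ), 1 ≤ s → ∀ x ∈ satOrders z I (s * e),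
      x ∈ orders z (idealClosure (I ^ e) ^ s) := by
    intro z s hs
    induction s, hs using Nat.le_induction with
    | base => intro x hx; rwa [one_mul, ← horders z, ← pow_one (idealClosure _)] at hx
    | succ s hs ih =>
      intro x hx
      rw [add_mul, one_mul] at hx
      obtain ⟨y, hy, hxy⟩ := exists_satOrders_sub_mem hA hI
        (he.trans (Nat.le_mul_of_pos_left e hs)) e hx
      rw [← horders z] at hy
      have := add_mem_orders_mul (IsGradedIdeal.pow hA hJ s) hJ (ih _ hxy) hy
      rwa [sub_add_cancel, ← pow_succ] at this
  refine isNormalIdeal_of_orders hR hA hJ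
    (fun s => IsGradedIdeal.idealClosure k hA (IsGradedIdeal.pow hA hJ s)) fun z s hs x hx => ?_
  obtain ⟨N, hN, hx⟩ := hx
  refine hsup z s hs x (satOrders_of_nsmul hN ?_)
  rw [← mul_assoc]
  exact hsub z _ hx

end LargePowers

/-! ### The algebra of a polyhedral divisor -/

section Divisor

open IsDedekindDomain

variable {ι : Type*}

theorem castQ_nsmul (N : ℕ) (m : ι → ℤ) : castQ (N • m) = (N : ℚ) • castQ m := by
  ext i; simp [castQ]

theorem castQ_sum {α : Type*} (s : Finset α) (f : α → ι → ℤ) :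
    castQ (∑ j ∈ s, f j) = ∑ j ∈ s, castQ (f j) := by
  ext i; simp [castQ]

theorem castQ_extend (m : ι → ℤ) (c : ℤ) : castQ (extend m c) = extend (castQ m) (c : ℚ) := by
  ext i; rcases i with i | i <;> simp [castQ, extend]

variable {R : Type*} [CommRing R] [IsDedekindDomain R]
variable {K : Type*} [Field K] [Algebra R K] [IsFractionRing R K]
variable [Fintype ι]

/-- If `N • x` is the sum of `N * s` lattice points of a convex set `C`, then `x ∈ s • C`. -/
theorem castQ_mem_smul {C : Set (ι → ℚ)} (hC : Convex ℚ C) {N s : ℕ} (hN : 1 ≤ N) (hs : 1 ≤ s)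
    {x : ι → ℤ} {f : Fin (N * s) → ι → ℤ} (hf : ∀ j, castQ (f j) ∈ C) (h : ∑ j, f j = N • x) :
    castQ x ∈ (s : ℚ) • C := by
  have hN0 : (N : ℚ) ≠ 0 := by positivity
  have hs0 : (s : ℚ) ≠ 0 := by positivity
  refine ⟨∑ j : Fin (N * s), ((N * s : ℚ)⁻¹) • castQ (f j), ?_, ?_⟩
  · refine hC.sum_mem (fun j _ => by positivity) ?_ fun j _ => hf j
    rw [Finset.sum_const, Finset.card_univ, Fintype.card_fin, nsmul_eq_mul]
    push_cast
    field_simp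
  · dsimp only
    rw [← Finset.smul_sum, ← castQ_sum, h, castQ_nsmul, smul_smul, smul_smul]
    rw [show (s : ℚ) * (N * s : ℚ)⁻¹ * N = 1 by field_simp, one_smul]

/-- There are sections of `𝒪(⌊D⌋)` of minimal order at a given point. -/
theorem exists_mem_globalSections (D : HeightOneSpectrum R → ℚ) (hD : {y | D y ≠ 0}.Finite)
    (z : HeightOneSpectrum R) :
    ∃ g ∈ globalSections K D, z.valuation K g = WithZero.exp ⌊D z⌋ := by
  classical
  obtain ⟨u, hu⟩ := z.valuation_surjective K (WithZero.exp ⌊D z⌋)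
  have hu0 : u ≠ 0 := by
    rintro rfl
    rw [map_zero] at hu
    exact WithZero.exp_ne_zero hu.symm
  have hfin : ({y | D y ≠ 0} ∪ {y : HeightOneSpectrum R | 1 < y.valuation K u}).Finite :=
    hD.union (HeightOneSpectrum.Support.finite R u)
  have hc : ∀ y : HeightOneSpectrum R, ∃ a : R, a ∉ z.asIdeal ∧ (y ≠ z →
      y.valuation K (algebraMap R K a * u) ≤ WithZero.exp ⌊D y⌋) := by
    intro y
    by_cases hy : y = z
    · exact ⟨1, (Ideal.ne_top_iff_one _).mp z.isPrime.ne_top, fun h => absurd hy h⟩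
    have hne : ¬ y.asIdeal ≤ z.asIdeal := by
      intro hle
      exact hy (HeightOneSpectrum.ext (y.isMaximal.eq_of_le z.isPrime.ne_top hle))
    obtain ⟨a, hay, haz⟩ := Set.not_subset.mp hne
    obtain ⟨c, hc⟩ := exists_valuation_eq_exp y hu0
    -- At `y`, `a` has order at least 1 and `u` has order `c`, while order at least `-⌊D y⌋` is
    -- required. As `a` does not vanish at `z`, nothing changes there.
    refine ⟨a ^ (-c - ⌊D y⌋).toNat, fun h => haz (z.isPrime.mem_of_pow_mem _ h), fun _ => ?_⟩
    have h1 : y.valuation K (algebraMap R K a) ≤ WithZero.exp (-1) := by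
      have := (y.valuation_lt_one_iff_mem (K := K) a).mpr hay
      by_cases h0 : algebraMap R K a = 0
      · rw [h0, map_zero]; exact zero_le
      obtain ⟨d, hd⟩ := exists_valuation_eq_exp y h0
      rw [hd, ← WithZero.exp_zero, WithZero.exp_lt_exp] at this
      rw [hd, WithZero.exp_le_exp]
      omega
    rw [map_mul, map_pow, map_pow, hc]
    refine (mul_le_mul' (pow_le_pow_left₀ zero_le h1 _) le_rfl).trans ?_
    rw [← WithZero.exp_nsmul, ← WithZero.exp_add, WithZero.exp_le_exp, nsmul_eq_mul]
    have := Int.self_le_toNat (-c - ⌊D y⌋)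
    omega
  choose a haz ha using hc
  refine ⟨algebraMap R K (∏ y ∈ hfin.toFinset, a y) * u, fun y => ?_, ?_⟩
  · by_cases hyz : y = z
    · subst hyz
      rw [map_mul, hu]
      exact mul_le_of_le_one_left' (y.valuation_le_one _)
    by_cases hy : y ∈ hfin.toFinset
    · rw [← Finset.mul_prod_erase _ _ hy, mul_comm (a y), map_mul (algebraMap R K), mul_assoc,
        map_mul (y.valuation K)]
      exact (mul_le_of_le_one_left' (y.valuation_le_one _)).trans (ha y hyz)
    · rw [Set.Finite.mem_toFinset] at hy
      simp only [Set.mem_union, Set.mem_ofPred_eq, not_or, not_not, not_lt] at hy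
      rw [map_mul, hy.1, Int.floor_zero, WithZero.exp_zero]
      exact mul_le_one' (y.valuation_le_one _) hy.2
  · rw [map_mul, hu, (z.valuation_eq_one_iff_notMem (K := K)).mpr, one_mul]
    exact fun h => by
      obtain ⟨y, -, hy⟩ := (z.isPrime.prod_mem_iff).mp h
      exact haz y hy

namespace PolyhedralDivisor

variable {σ : PointedCone ℚ (ι → ℚ)} (D : PolyhedralDivisor R σ)

theorem eval_nsmul {m : ι → ℤ} (hm : castQ m ∈ dualCone (σ : Set (ι → ℚ)))
    (N : ℕ) (z : HeightOneSpectrum R) : D.eval (N • m) z = N * D.eval m z := by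
  have h := (D.isTailedPolyhedron z).isLeast_supportFn hm
  refine supportFn_eq ⟨?_, ?_⟩
  · obtain ⟨v, hv, hv'⟩ := h.1
    refine ⟨v, hv, ?_⟩
    dsimp only at hv' ⊢
    rw [castQ_nsmul, smul_dotProduct, hv', smul_eq_mul]
    rfl
  · rintro _ ⟨v, hv, rfl⟩
    have := h.2 ⟨v, hv, rfl⟩
    dsimp only at this ⊢
    rw [castQ_nsmul, smul_dotProduct, smul_eq_mul]
    exact mul_le_mul_of_nonneg_left this (by positivity)

theorem isGradedIdeal_top : IsGradedIdeal (⊤ : Ideal (D.algebra K)) := by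
  classical
  intro F _ m
  refine ⟨⟨AddMonoidAlgebra.single m ((F : AddMonoidAlgebra K (ι → ℤ)).coeff m), fun m' => ?_⟩,
    trivial, rfl⟩
  rw [AddMonoidAlgebra.coeff_single, Finsupp.single_apply]
  split_ifs with h
  · exact h ▸ F.2 m
  · exact Submodule.zero_mem _

theorem single_mem_algebra_iff {m : ι → ℤ} {f : K} :
    AddMonoidAlgebra.single m f ∈ D.algebra K ↔ f ∈ D.piece K m := by
  classical
  constructor
  · intro h
    have := h m
    rwa [AddMonoidAlgebra.coeff_single, Finsupp.single_eq_same] at this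
  · intro h m'
    rw [AddMonoidAlgebra.coeff_single, Finsupp.single_apply]
    split_ifs with h'
    · exact h' ▸ h
    · exact Submodule.zero_mem _

/-- Support functions are positively homogeneous, so the order condition for `f ^ N` in degree `N •
m` is `N` times the one for `f`; the floors are harmless because orders are integers. -/
theorem isRootClosed_algebra : IsRootClosed (D.algebra K) := by
  intro N m f hN h
  rw [single_mem_algebra_iff] at h ⊢
  by_cases hf : f = 0
  · rw [hf]; exact Submodule.zero_mem _
  have hN0 : (0 : ℚ) < N := by exact_mod_cast hN
  by_cases hNm : castQ (N • m) ∈ dualCone (σ : Set (ι → ℚ))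
  swap
  · rw [piece, if_neg hNm, Submodule.mem_bot] at h
    exact absurd (eq_zero_of_pow_eq_zero h) hf
  have hm : castQ m ∈ dualCone (σ : Set (ι → ℚ)) := by
    rw [mem_dualCone] at hNm ⊢
    intro v hv
    have := hNm v hv
    rw [castQ_nsmul, smul_dotProduct, smul_eq_mul] at this
    exact nonneg_of_mul_nonneg_right this hN0
  rw [piece, if_pos hNm] at h
  rw [piece, if_pos hm]
  intro z
  have hz := h z
  obtain ⟨c, hc⟩ := exists_valuation_eq_exp z hf
  rw [map_pow, hc, ← WithZero.exp_nsmul, WithZero.exp_le_exp, D.eval_nsmul hm, Int.le_floor,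
    nsmul_eq_mul] at hz
  rw [hc, WithZero.exp_le_exp, Int.le_floor]
  push_cast at hz ⊢
  exact le_of_mul_le_mul_left hz hN0

theorem IsHomogeneousIdeal.isGradedIdeal {I : Ideal (D.algebra K)}
    (hI : D.IsHomogeneousIdeal K I) : IsGradedIdeal I := by
  obtain ⟨-, S, hS, rfl⟩ := hI
  exact isGradedIdeal_span D.isGradedIdeal_top hS

/-- The tail cone of `D'` is the dual of the Rees cone; membership in the bidual ensures that the
support functions are true minima at `(m, 1)`. -/
theorem extend_one_mem_dualCone {P : Set (ι → ℚ)} {m : ι → ℚ} (hm : m ∈ P) :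
    extend m 1 ∈ dualCone (dualCone (reesCone σ P) : Set (ι ⊕ Unit → ℚ)) := by
  rw [mem_dualCone]
  intro w hw
  rw [dotProduct_comm]
  exact mem_dualCone.mp hw _ ⟨m, 1, rfl, Or.inr ⟨one_pos, by rwa [one_smul]⟩⟩

/-! ### Orders of an ideal with a given associated pair -/

section AssociatedPair

variable {D} {I : Ideal (D.algebra K)} {P : Set (ι → ℚ)}
  {D' : PolyhedralDivisor R (dualCone (reesCone σ P))}

theorem eval_extend_one_of_notMem_support {z : HeightOneSpectrum R} (hz : z ∉ D'.support)
    {m : ι → ℤ} (hm : castQ m ∈ P) : D'.eval (extend m 1) z = 0 := by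
  have hz' : D'.coeff z = (dualCone (reesCone σ P) : Set (ι ⊕ Unit → ℚ)) := not_not.mp hz
  have h := mem_dualCone.mp (extend_one_mem_dualCone (σ := σ) hm)
  rw [eval, castQ_extend, Int.cast_one]
  refine supportFn_eq ⟨⟨0, ?_, dotProduct_zero _⟩, ?_⟩
  · rw [hz']; exact zero_mem (dualCone (reesCone σ P))
  · rintro _ ⟨v, hv, rfl⟩
    rw [hz'] at hv
    exact h v hv

theorem le_eval_extend_one_iff {z : HeightOneSpectrum R} {m : ι → ℤ} (hm : castQ m ∈ P) {a : ℚ} :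
    a ≤ D'.eval (extend m 1) z ↔ ∀ w ∈ D'.coeff z, a ≤ extend (castQ m) 1 ⬝ᵥ w := by
  have h := (D'.isTailedPolyhedron z).isLeast_supportFn (extend_one_mem_dualCone hm)
  rw [eval, castQ_extend, Int.cast_one]
  constructor
  · exact fun ha w hw => ha.trans (h.2 ⟨w, hw, rfl⟩)
  · intro ha
    obtain ⟨w, hw, hw'⟩ := h.1
    rw [← hw']
    exact ha w hw

/-- The convex hull adds no lattice point: support functions are concave, so the defining conditions
already cut out a convex set. -/
theorem castQ_extend_mem_localPolyhedron_iff (hP : Convex ℚ P) {z : HeightOneSpectrum R}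
    {m : ι → ℤ} {c : ℤ} : castQ (extend m c) ∈ D'.localPolyhedron P z ↔
      castQ m ∈ P ∧ -(c : ℚ) ≤ D'.eval (extend m 1) z := by
  constructor
  swap
  · exact fun h => subset_convexHull ℚ _ ⟨m, c, rfl, h.1, h.2⟩
  intro h
  let C : Set (ι ⊕ Unit → ℚ) := {x | (fun i => x (Sum.inl i)) ∈ P ∧ ∀ w ∈ D'.coeff z,
    -(x (Sum.inr ())) ≤ extend (fun i => x (Sum.inl i)) 1 ⬝ᵥ w}
  have hC : Convex ℚ C := by
    rintro x ⟨hx, hx'⟩ y ⟨hy, hy'⟩ a b ha hb hab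
    refine ⟨hP hx hy ha hb hab, fun w hw => ?_⟩
    have h1 := mul_le_mul_of_nonneg_left (hx' w hw) ha
    have h2 := mul_le_mul_of_nonneg_left (hy' w hw) hb
    have h3 : extend (fun i => (a • x + b • y) (Sum.inl i)) (1 : ℚ) ⬝ᵥ w =
        a * (extend (fun i => x (Sum.inl i)) 1 ⬝ᵥ w) +
          b * (extend (fun i => y (Sum.inl i)) 1 ⬝ᵥ w) := by
      rw [← smul_eq_mul, ← smul_eq_mul, ← smul_dotProduct, ← smul_dotProduct, ← add_dotProduct]
      congr 1
      ext i
      rcases i with i | i <;> simp [extend, hab]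
    rw [h3]
    simp only [Pi.add_apply, Pi.smul_apply, smul_eq_mul]
    linarith
  have hsub : D'.localPolyhedron P z ⊆ C := by
    refine convexHull_min ?_ hC
    rintro _ ⟨m, i, rfl, hm, hi⟩
    rw [le_eval_extend_one_iff hm] at hi
    rw [castQ_extend]
    exact ⟨hm, hi⟩
  have h1 := hsub h
  rw [castQ_extend] at h1
  have hm : castQ m ∈ P := h1.1
  exact ⟨hm, (le_eval_extend_one_iff hm).mpr h1.2⟩

theorem IsAssociatedPair.convex (h : D.IsAssociatedPair K I P D') : Convex ℚ P := by
  obtain ⟨Q, -, -, rfl⟩ := h.polyhedron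
  exact (convex_convexHull ℚ _).add (dualCone (σ : Set (ι → ℚ))).toConvexCone.convex

/-- The minimal order allowed at `z` is attained by a global section because the curve is affine
(`exists_mem_globalSections`). -/
theorem IsAssociatedPair.mem_orders_iff (h : D.IsAssociatedPair K I P D')
    {z : HeightOneSpectrum R} {x : (ι → ℤ) × ℤ} :
    x ∈ orders z I ↔ castQ x.1 ∈ P ∧ -(x.2 : ℚ) ≤ D'.eval (extend x.1 1) z := by
  classical
  obtain ⟨m, c⟩ := x
  constructor
  · rintro ⟨F, hF, hle⟩
    have hmem : (F : AddMonoidAlgebra K (ι → ℤ)) ∈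
        ((↑) : D.algebra K → AddMonoidAlgebra K (ι → ℤ)) '' (I : Set (D.algebra K)) :=
      ⟨F, hF, rfl⟩
    rw [h.ideal_eq] at hmem
    have hne : (F : AddMonoidAlgebra K (ι → ℤ)).coeff m ≠ 0 := by
      intro h0
      dsimp only at hle
      rw [h0, map_zero] at hle
      exact absurd hle (not_le.mpr WithZero.exp_pos)
    obtain ⟨hm, hs⟩ := hmem m hne
    have := hle.trans (hs z)
    rw [WithZero.exp_le_exp, Int.le_floor] at this
    exact ⟨hm, by simpa using this⟩
  · rintro ⟨hm, hc⟩
    obtain ⟨g, hg, hgz⟩ := exists_mem_globalSections (K := K) (D'.eval (extend m 1))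
      (D'.finite_support.subset fun y hy => by
        by_contra hy'
        exact hy (eval_extend_one_of_notMem_support hy' hm)) z
    have hmem : AddMonoidAlgebra.single m g ∈
        ((↑) : D.algebra K → AddMonoidAlgebra K (ι → ℤ)) '' (I : Set (D.algebra K)) := by
      rw [h.ideal_eq]
      intro m' hm'
      rw [AddMonoidAlgebra.coeff_single, Finsupp.single_apply] at hm' ⊢
      split_ifs at hm' ⊢ with h'
      · subst h'
        exact ⟨hm, hg⟩
      · exact absurd rfl hm'
    obtain ⟨F, hF, hFg⟩ := hmem
    refine ⟨F, hF, ?_⟩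
    dsimp only at hFg hc ⊢
    rw [hFg, AddMonoidAlgebra.coeff_single, Finsupp.single_eq_same, hgz, WithZero.exp_le_exp,
      Int.le_floor]
    simpa using hc

/-- Averaging the `N * s` points puts `x` in `s` times the local polyhedron by convexity; normality
then breaks it into `s` lattice points, that is, orders of `I`. -/
theorem IsAssociatedPair.mem_orders_pow (h : D.IsAssociatedPair K I P D') (hI : IsGradedIdeal I)
    {z : HeightOneSpectrum R} (hz : IsNormalPolyhedron (D'.localPolyhedron P z))
    {N s : ℕ} (hN : 1 ≤ N) (hs : 1 ≤ s) {x : (ι → ℤ) × ℤ} {f : Fin (N * s) → (ι → ℤ) × ℤ}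
    (hf : ∀ j, f j ∈ orders z I) (hfx : ∑ j, f j = N • x) : x ∈ orders z (I ^ s) := by
  have h1 : castQ (extend x.1 x.2) ∈ (s : ℚ) • D'.localPolyhedron P z := by
    refine castQ_mem_smul (C := D'.localPolyhedron P z) (convex_convexHull ℚ _) hN hs (f := fun j => extend (f j).1 (f j).2)
      (fun j => ?_) ?_
    · rw [castQ_extend_mem_localPolyhedron_iff h.convex]
      exact h.mem_orders_iff.mp (hf j)
    · have e1 := congrArg Prod.fst hfx
      have e2 := congrArg Prod.snd hfx
      rw [Prod.fst_sum] at e1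
      rw [Prod.snd_sum] at e2
      ext i
      rcases i with i | i
      · simpa [extend] using congrFun e1 i
      · simpa [extend] using e2
  obtain ⟨g, hg, hgx⟩ := (hz s hs _).mp h1
  have h2 : x = ∑ j, ((fun i => g j (Sum.inl i), g j (Sum.inr ())) : (ι → ℤ) × ℤ) := by
    refine Prod.ext ?_ ?_
    · rw [Prod.fst_sum]
      ext i
      have := congrFun hgx (Sum.inl i)
      simpa [extend] using this.symm
    · rw [Prod.snd_sum]
      have := congrFun hgx (Sum.inr ())
      simpa [extend] using this.symm
  rw [h2]
  refine sum_mem_orders_pow D.isGradedIdeal_top hI fun j => ?_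
  rw [h.mem_orders_iff, ← castQ_extend_mem_localPolyhedron_iff h.convex]
  convert hg j using 2
  ext i
  rcases i with i | i <;> simp [extend]

/-- The ideal `I` is normal if the polyhedra `P'_z` are. -/
theorem IsAssociatedPair.isNormalIdeal (k : Type*) [Field k] [CharZero k] [Algebra k R]
    (hR : ¬ IsField R) (h : D.IsAssociatedPair K I P D') (hI : IsGradedIdeal I)
    (hsupp : ∀ z ∈ D'.support, IsNormalPolyhedron (D'.localPolyhedron P z))
    (hempty : D'.support = ∅ → IsNormalPolyhedron P) : IsNormalIdeal I := by
  classical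
  have hA := D.isGradedIdeal_top (K := K)
  refine isNormalIdeal_of_orders hR hA hI
    (fun s => IsGradedIdeal.idealClosure k hA (IsGradedIdeal.pow hA hI s)) ?_
  rintro z s hs ⟨m, c⟩ ⟨N, hN, hx⟩
  obtain ⟨f, hf, hfx⟩ := exists_sum_eq_of_mem_orders_pow (Nat.mul_pos hN hs) hx
  by_cases hz : z ∈ D'.support
  · exact h.mem_orders_pow hI (hsupp z hz) hN hs hf hfx
  have hfP : ∀ j, castQ (f j).1 ∈ P := fun j => (h.mem_orders_iff.mp (hf j)).1
  have e1 : ∑ j, (f j).1 = N • m := by rw [← Prod.fst_sum, hfx]; rfl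
  have e2 : ∑ j, (f j).2 = N • c := by rw [← Prod.snd_sum, hfx]; rfl
  -- Off the support the order condition is just nonnegativity, so it suffices to decompose the
  -- degree `m` in `P`.
  obtain ⟨g, hg, hgm⟩ : ∃ g : Fin s → (ι → ℤ), (∀ j, castQ (g j) ∈ P) ∧ ∑ j, g j = m := by
    rcases D'.support.eq_empty_or_nonempty with h0 | ⟨z₀, hz₀⟩
    · exact (hempty h0 s hs m).mp (castQ_mem_smul h.convex hN hs hfP e1)
    · have hb : ∀ j, ∃ b : ℤ, -(b : ℚ) ≤ D'.eval (extend (f j).1 1) z₀ := fun j =>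
        ⟨⌈-(D'.eval (extend (f j).1 1) z₀)⌉, by
          have := Int.le_ceil (-(D'.eval (extend (f j).1 1) z₀)); linarith⟩
      choose b hb using hb
      -- A common height, large enough for every `(f j, B)` to lie in the local polyhedron at `z₀`;
      -- a decomposition there projects to one in `P`.
      set B : ℤ := ∑ j, |b j|
      have hbB : ∀ j, b j ≤ B := fun j => (le_abs_self _).trans
        (Finset.single_le_sum (f := fun j => |b j|) (fun _ _ => abs_nonneg _) (Finset.mem_univ j))
      have h1 : (m, s * B) ∈ orders z₀ (I ^ s) := by
        refine h.mem_orders_pow hI (hsupp z₀ hz₀) hN hs (f := fun j => ((f j).1, B))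
          (fun j => orders_of_le (hbB j) (h.mem_orders_iff.mpr ⟨hfP j, hb j⟩)) ?_
        refine Prod.ext ?_ ?_
        · rw [Prod.fst_sum]; exact e1
        · rw [Prod.snd_sum]; simp [mul_assoc]
      obtain ⟨g, hg, hgm⟩ := exists_sum_eq_of_mem_orders_pow hs h1
      exact ⟨fun j => (g j).1, fun j => (h.mem_orders_iff.mp (hg j)).1, by
        rw [← Prod.fst_sum, hgm]⟩
  have hc : 0 ≤ c := by
    have h1 : (0 : ℤ) ≤ ∑ j, (f j).2 := Finset.sum_nonneg fun j _ => by
      have h2 := (h.mem_orders_iff.mp (hf j)).2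
      rw [eval_extend_one_of_notMem_support hz (hfP j)] at h2
      have h3 : (0 : ℚ) ≤ ((f j).2 : ℚ) := by linarith
      exact_mod_cast h3
    rw [e2, nsmul_eq_mul] at h1
    exact nonneg_of_mul_nonneg_right h1 (by exact_mod_cast hN)
  let j₀ : Fin s := ⟨0, hs⟩
  -- The whole order `c ≥ 0` is given to one summand.
  have h2 : (m, c) = ∑ j, ((g j, if j = j₀ then c else 0) : (ι → ℤ) × ℤ) := by
    refine Prod.ext ?_ ?_
    · rw [Prod.fst_sum]; exact hgm.symm
    · rw [Prod.snd_sum]; simp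
  rw [h2]
  refine sum_mem_orders_pow hA hI fun j => h.mem_orders_iff.mpr ⟨hg j, ?_⟩
  rw [eval_extend_one_of_notMem_support hz (hg j)]
  dsimp only
  split_ifs <;> simp [hc]

end AssociatedPair

end PolyhedralDivisor

end Divisor

/-! ### Transcendence degree and dimension -/

section Dimension

universe u v

/-- Lying over and going up lift chains of primes from `S` to `T`. -/
theorem ringKrullDim_le_of_isIntegral {S T : Type*} [CommRing S] [CommRing T] [Algebra S T]
    [Algebra.IsIntegral S T] (hinj : Function.Injective (algebraMap S T)) :
    ringKrullDim S ≤ ringKrullDim T := by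
  refine iSup_le fun l => ?_
  obtain ⟨P, -, hP, hPl⟩ := Ideal.exists_ideal_over_prime_of_isIntegral l.head.asIdeal
    (⊥ : Ideal T) (by
      rw [← RingHom.ker_eq_comap_bot, (RingHom.injective_iff_ker_eq_bot _).mp hinj]; exact bot_le)
  have : P.LiesOver l.head.asIdeal := ⟨hPl.symm⟩
  obtain ⟨L, hL, -⟩ := Ideal.exists_ltSeries_of_hasGoingUp l P
  rw [← hL]
  exact le_iSup (fun p : LTSeries (PrimeSpectrum T) => (p.length : WithBot ℕ∞)) L

/-- By Noether normalization `B` is integral over a polynomial ring in `s` variables: its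
transcendence degree is `s`, and `s ≤ n` by comparison of dimensions. -/
theorem trdeg_le_of_ringKrullDim_eq {k : Type u} {B : Type v} [Field k] [CommRing B] [IsDomain B] [Algebra k B]
    [Algebra.FiniteType k B] {n : ℕ} (h : ringKrullDim B = n) : Algebra.trdeg k B ≤ n := by
  obtain ⟨s, g, hg, hgi⟩ := exists_integral_inj_algHom_of_fg k B
  algebraize [g.toRingHom]
  have hint : Algebra.IsIntegral (MvPolynomial (Fin s) k) B := ⟨hgi⟩
  have hinj : Function.Injective (algebraMap (MvPolynomial (Fin s) k) B) := hg
  have h1 := ringKrullDim_le_of_isIntegral hinj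
  rw [MvPolynomial.ringKrullDim_of_isNoetherianRing, ringKrullDim_eq_zero_of_field, zero_add, h,
    Nat.card_eq_fintype_card, Fintype.card_fin] at h1
  have hsn : s ≤ n := by exact_mod_cast h1
  have : FaithfulSMul (MvPolynomial (Fin s) k) B := (faithfulSMul_iff_algebraMap_injective _ _).mpr hinj
  have : IsScalarTower k (MvPolynomial (Fin s) k) B :=
    IsScalarTower.of_algebraMap_eq fun x => (g.commutes x).symm
  have h2 := lift_trdeg_add_eq k (MvPolynomial (Fin s) k) B
  rw [MvPolynomial.trdeg_of_isDomain, trdeg_eq_zero] at h2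
  rw [Cardinal.lift_zero, add_zero] at h2
  rw [← Cardinal.lift_le.{u}, ← h2]
  simpa using hsn

end Dimension

/-! ### Weights of algebraic actions of the multiplicative group -/

section Weights

variable {k C : Type*} [Field k] [CommRing C] [Algebra k C]

theorem mul_mem_weightSpace {ρ : kˣ →* (C ≃ₐ[k] C)} {m m' : ℤ} {x y : C}
    (hx : x ∈ weightSpace ρ m) (hy : y ∈ weightSpace ρ m') : x * y ∈ weightSpace ρ (m + m') := by
  intro t
  rw [map_mul, hx t, hy t, smul_mul_smul_comm, zpow_add, Units.val_mul]

theorem algebraMap_mem_weightSpace (ρ : kˣ →* (C ≃ₐ[k] C)) (a : k) :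
    algebraMap k C a ∈ weightSpace ρ 0 := fun t => by simp

/-- Independence of characters; the powers `t ↦ t ^ w i` are distinct because `2` has infinite
order. -/
theorem eq_zero_of_forall_sum_zpow_smul_eq_zero [CharZero k] [IsDomain C] {α : Type*} {w : α → ℤ}
    (hw : Function.Injective w) {s : Finset α} {x : α → C}
    (h : ∀ t : kˣ, ∑ i ∈ s, ((t ^ w i : kˣ) : k) • x i = 0) : ∀ i ∈ s, x i = 0 := by
  let φ : α → (kˣ →* C) := fun i =>
    ((algebraMap k C : k →* C).comp (Units.coeHom k)).comp (zpowGroupHom (w i))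
  have hφ : Function.Injective φ := by
    intro i j hij
    apply hw
    apply two_zpow_injective (k := k)
    have h1 := DFunLike.congr_fun hij (Units.mk0 (2 : k) two_ne_zero)
    simp only [φ, MonoidHom.comp_apply, zpowGroupHom_apply, Units.coeHom_apply] at h1
    exact Units.ext ((algebraMap k C).injective h1)
  refine linearIndependent_iff'.mp ((linearIndependent_monoidHom kˣ C).comp φ hφ) s x ?_
  ext t
  rw [Finset.sum_apply, Pi.zero_apply, ← h t]
  refine Finset.sum_congr rfl fun i _ => ?_
  simp [φ, Algebra.smul_def, mul_comm]

theorem eq_zero_of_sum_weight_eq_zero [CharZero k] [IsDomain C] {ρ : kˣ →* (C ≃ₐ[k] C)}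
    {α : Type*} {w : α → ℤ} (hw : Function.Injective w) {s : Finset α} {x : α → C}
    (hx : ∀ i ∈ s, x i ∈ weightSpace ρ (w i)) (h : ∑ i ∈ s, x i = 0) : ∀ i ∈ s, x i = 0 := by
  refine eq_zero_of_forall_sum_zpow_smul_eq_zero (k := k) hw fun t => ?_
  rw [← map_zero (ρ t), ← h, map_sum]
  exact Finset.sum_congr rfl fun i hi => (hx i hi t).symm

/-- Comparing `ρ (s * t) b` with `ρ s (ρ t b)` as Laurent polynomials in `t` shows that the
coefficients are weight vectors; `t = 1` gives their sum. -/
theorem exists_sum_weight_eq [CharZero k] [IsDomain C] {ρ : kˣ →* (C ≃ₐ[k] C)}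
    (hρ : IsAlgebraicAction ρ) (b : C) :
    ∃ c : ℤ →₀ C, (∀ m, c m ∈ weightSpace ρ m) ∧ ∑ m ∈ c.support, c m = b := by
  obtain ⟨c, hc⟩ := hρ b
  refine ⟨c, fun m s => ?_, ?_⟩
  · by_cases hm : m ∈ c.support
    swap
    · rw [Finsupp.notMem_support_iff.mp hm, map_zero, smul_zero]
    refine sub_eq_zero.mp (eq_zero_of_forall_sum_zpow_smul_eq_zero (k := k)
      (w := fun m : ℤ => m) (x := fun m => ρ s (c m) - ((s ^ m : kˣ) : k) • c m)
      Function.injective_id (fun t => ?_) m hm)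
    have h1 : ρ (s * t) b = ρ s (ρ t b) := by rw [map_mul]; rfl
    rw [hc, hc, Finsupp.sum, Finsupp.sum, map_sum] at h1
    rw [← sub_eq_zero.mpr h1.symm, ← Finset.sum_sub_distrib]
    refine Finset.sum_congr rfl fun i _ => ?_
    rw [map_smul, smul_sub, smul_smul, mul_zpow, mul_comm (s ^ i), Units.val_mul]
  · have := hc 1
    simpa [Finsupp.sum] using this.symm

end Weights

/-! ### Weight vectors in a field -/

section FieldWeights

variable {k L : Type*} [Field k] [Field L] [Algebra k L]

theorem inv_mem_weightSpace {ρ : kˣ →* (L ≃ₐ[k] L)} {m : ℤ} {x : L}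
    (hx : x ∈ weightSpace ρ m) : x⁻¹ ∈ weightSpace ρ (-m) := by
  intro t
  rw [map_inv₀, hx t, Algebra.smul_def, Algebra.smul_def, mul_inv, ← map_inv₀, zpow_neg,
    Units.val_inv_eq_inv_val]

theorem zpow_mem_weightSpace {ρ : kˣ →* (L ≃ₐ[k] L)} {x : L}
    (hx : x ∈ weightSpace ρ 1) (m : ℤ) : x ^ m ∈ weightSpace ρ m := by
  intro t
  rw [map_zpow₀, hx t, Algebra.smul_def, Algebra.smul_def, mul_zpow, ← map_zpow₀, zpow_one,
    Units.val_zpow_eq_zpow_val]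

/-- The subfield of invariants. -/
def invariantField (ρ : kˣ →* (L ≃ₐ[k] L)) : IntermediateField k L where
  carrier := weightSpace ρ 0
  mul_mem' hx hy := by simpa using mul_mem_weightSpace hx hy
  add_mem' hx hy := add_mem hx hy
  algebraMap_mem' a := algebraMap_mem_weightSpace ρ a
  inv_mem' x hx := by simpa using inv_mem_weightSpace hx

/-- The terms of a polynomial relation over the invariants have distinct weights, so each one
vanishes. -/
theorem transcendental_of_mem_weightSpace [CharZero k] {ρ : kˣ →* (L ≃ₐ[k] L)} {x : L}
    (hx : x ∈ weightSpace ρ 1) (hx0 : x ≠ 0) : Transcendental (invariantField ρ) x := by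
  rw [transcendental_iff]
  intro p hp
  rw [Polynomial.aeval_eq_sum_range] at hp
  have h := eq_zero_of_sum_weight_eq_zero (ρ := ρ) (w := fun i : ℕ => (i : ℤ))
    Nat.cast_injective (fun i _ => ?_) hp
  · ext i
    by_cases hi : i ∈ Finset.range (p.natDegree + 1)
    · have := h i hi
      rw [Algebra.smul_def] at this
      exact (mul_eq_zero.mp this).resolve_right (pow_ne_zero i hx0)
    · rw [Polynomial.coeff_eq_zero_of_natDegree_lt (by simpa using hi), Polynomial.coeff_zero]
  · have h1 := mul_mem_weightSpace (p.coeff i).2 (zpow_mem_weightSpace hx i)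
    rw [zero_add, zpow_natCast] at h1
    exact h1

end FieldWeights

/-! ### The induced action on the fraction field and a vector of weight 1 -/

section Invariants

variable {k B L : Type*} [Field k] [CommRing B] [Algebra k B]
  [Field L] [Algebra B L] [IsFractionRing B L] [Algebra k L] [IsScalarTower k B L]

/-- The ring of invariants. -/
def invariants (ρ : kˣ →* (B ≃ₐ[k] B)) : Subalgebra k B where
  carrier := weightSpace ρ 0
  mul_mem' hx hy := by simpa using mul_mem_weightSpace hx hy
  add_mem' hx hy := add_mem hx hy
  algebraMap_mem' a := algebraMap_mem_weightSpace ρ a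

variable (L) in
/-- The induced action on the field of fractions. -/
def fractionAction (ρ : kˣ →* (B ≃ₐ[k] B)) : kˣ →* (L ≃ₐ[k] L) :=
  (IsFractionRing.fieldEquivOfAlgEquivHom k L).comp ρ

theorem fractionAction_algebraMap (ρ : kˣ →* (B ≃ₐ[k] B)) (t : kˣ) (b : B) :
    fractionAction L ρ t (algebraMap B L b) = algebraMap B L (ρ t b) :=
  IsFractionRing.fieldEquivOfAlgEquiv_algebraMap k L L (ρ t) b

theorem algebraMap_mem_weightSpace_iff {ρ : kˣ →* (B ≃ₐ[k] B)} {m : ℤ} {b : B} :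
    algebraMap B L b ∈ weightSpace (fractionAction L ρ) m ↔ b ∈ weightSpace ρ m := by
  refine forall_congr' fun t => ?_
  rw [fractionAction_algebraMap, ← IsScalarTower.coe_toAlgHom' k B L, ← map_smul]
  exact (IsFractionRing.injective B L).eq_iff

/-- The weights occurring in the fraction field form a subgroup `dℤ`. Any `t` with `t ^ d = 1` acts
trivially, so by faithfulness there is no such `t ≠ 1`. The element `2` excludes `d = 0`, and a
primitive root of unity excludes `|d| > 1`. -/
theorem exists_mem_weightSpace_one [IsDomain B] [IsAlgClosed k] [CharZero k] {ρ : kˣ →* (B ≃ₐ[k] B)}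
    (hρ : IsAlgebraicAction ρ) (hinj : Function.Injective ρ) :
    ∃ x : L, x ≠ 0 ∧ x ∈ weightSpace (fractionAction L ρ) 1 := by
  let H : AddSubgroup ℤ :=
    { carrier := {m | ∃ x : L, x ≠ 0 ∧ x ∈ weightSpace (fractionAction L ρ) m}
      zero_mem' := ⟨1, one_ne_zero, by
        simpa using algebraMap_mem_weightSpace (fractionAction L ρ) (1 : k)⟩
      add_mem' := by
        rintro _ _ ⟨x, hx, hx'⟩ ⟨y, hy, hy'⟩
        exact ⟨x * y, mul_ne_zero hx hy, mul_mem_weightSpace hx' hy'⟩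
      neg_mem' := by
        rintro _ ⟨x, hx, hx'⟩
        exact ⟨x⁻¹, inv_ne_zero hx, inv_mem_weightSpace hx'⟩ }
  obtain ⟨d, hd⟩ := Int.subgroup_cyclic H
  have key : ∀ t : kˣ, t ^ d = 1 → t = 1 := by
    intro t ht
    apply hinj
    rw [map_one]
    ext b
    obtain ⟨c, hc, hcb⟩ := exists_sum_weight_eq hρ b
    rw [← hcb, map_sum]
    refine Finset.sum_congr rfl fun m hm => ?_
    have hmH : m ∈ H := ⟨algebraMap B L (c m), by simpa using hm,
      algebraMap_mem_weightSpace_iff.mpr (hc m)⟩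
    rw [hd, AddSubgroup.mem_closure_singleton] at hmH
    obtain ⟨j, rfl⟩ := hmH
    rw [hc _ t, smul_eq_mul, mul_comm, zpow_mul, ht]
    simp
  have hd1 : d.natAbs = 1 := by
    rcases Nat.eq_zero_or_pos d.natAbs with h0 | h0
    · have := key (Units.mk0 (2 : k) two_ne_zero) (by rw [Int.natAbs_eq_zero.mp h0, zpow_zero])
      have h2 := congrArg Units.val this
      simp at h2
    · have : NeZero (d.natAbs : k) := ⟨by exact_mod_cast h0.ne'⟩
      obtain ⟨ζ, hζ⟩ := HasEnoughRootsOfUnity.exists_primitiveRoot k d.natAbs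
      have hu := hζ.isUnit h0.ne'
      have h1 : hu.unit ^ d.natAbs = 1 := Units.ext (by simpa using hζ.pow_eq_one)
      have h2 := key hu.unit (by
        rcases Int.natAbs_eq d with h | h <;> rw [h]
        · rw [zpow_natCast, h1]
        · rw [zpow_neg, zpow_natCast, h1, inv_one])
      have h3 : ζ = 1 := congrArg Units.val h2
      subst h3
      exact hζ.unique IsPrimitiveRoot.one
  have : (1 : ℤ) ∈ H := by
    rw [hd, AddSubgroup.mem_closure_singleton]
    exact ⟨d, by rw [smul_eq_mul, ← Int.natAbs_mul_self' d, hd1]; rfl⟩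
  exact this

end Invariants

/-! ### The curve of invariants -/

section InvariantCurve

variable {k B L : Type*} [Field k] [CommRing B] [Algebra k B]
  [Field L] [Algebra B L] [IsFractionRing B L] [Algebra k L] [IsScalarTower k B L]

instance (ρ : kˣ →* (B ≃ₐ[k] B)) :
    Algebra (invariants ρ) (invariantField (fractionAction L ρ)) :=
  RingHom.toAlgebra
    { toFun b := ⟨algebraMap B L b, algebraMap_mem_weightSpace_iff.mpr b.2⟩
      map_one' := by ext; simp
      map_mul' _ _ := by ext; simp
      map_zero' := by ext; simp
      map_add' _ _ := by ext; simp }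

instance (ρ : kˣ →* (B ≃ₐ[k] B)) :
    IsScalarTower (invariants ρ) (invariantField (fractionAction L ρ)) L :=
  IsScalarTower.of_algebraMap_eq fun _ => rfl

instance (ρ : kˣ →* (B ≃ₐ[k] B)) :
    IsScalarTower k (invariants ρ) (invariantField (fractionAction L ρ)) :=
  IsScalarTower.of_algebraMap_eq fun x => Subtype.ext (IsScalarTower.algebraMap_apply k B L x)

instance (ρ : kˣ →* (B ≃ₐ[k] B)) :
    FaithfulSMul (invariants ρ) (invariantField (fractionAction L ρ)) :=
  (faithfulSMul_iff_algebraMap_injective _ _).mpr fun _ _ h =>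
    Subtype.ext (IsFractionRing.injective B L (congrArg Subtype.val h))

/-- Such an element lies in `B` by normality, and is invariant. -/
theorem exists_algebraMap_eq_of_isIntegral [IsIntegrallyClosed B] {ρ : kˣ →* (B ≃ₐ[k] B)}
    {x : invariantField (fractionAction L ρ)} (hx : IsIntegral (invariants ρ) x) :
    ∃ y, algebraMap (invariants ρ) (invariantField (fractionAction L ρ)) y = x := by
  have h1 : IsIntegral (invariants ρ) (x : L) := hx.algebraMap
  have h2 : IsIntegral B (x : L) := h1.tower_top
  obtain ⟨b, hb⟩ := IsIntegrallyClosed.isIntegral_iff.mp h2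
  exact ⟨⟨b, algebraMap_mem_weightSpace_iff.mp (hb ▸ x.2)⟩, Subtype.ext hb⟩

theorem exists_transcendental_of_not_isElliptic [IsDomain B] [IsAlgClosed k]
    {ρ : kˣ →* (B ≃ₐ[k] B)} (hell : ¬ IsElliptic ρ) :
    ∃ r : invariants ρ, Transcendental k r := by
  by_contra! h
  apply hell
  have : Algebra.IsAlgebraic k (invariants ρ) := ⟨fun r => by
    have := h r
    simpa [Transcendental] using this⟩
  have hb := IsAlgClosed.algebraMap_bijective_of_isIntegral (k := k) (K := invariants ρ)
  refine le_antisymm (fun b hb' => ?_) (Submodule.one_le.mpr ?_)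
  · obtain ⟨a, ha⟩ := hb.2 ⟨b, hb'⟩
    exact Submodule.mem_one.mpr ⟨a, congrArg Subtype.val ha⟩
  · exact (invariants ρ).one_mem

end InvariantCurve

/-! ### Dimension and Noetherianity of the ring of invariants -/

section Dim

universe u v

variable {k : Type u} {B L : Type v} [Field k] [CommRing B] [Algebra k B]
  [Field L] [Algebra B L] [IsFractionRing B L] [Algebra k L] [IsScalarTower k B L]

/-- The fraction field has transcendence degree at most 2, and `x` uses up one over the invariants.
-/
theorem trdeg_invariantField_le [CharZero k] [IsDomain B] [Algebra.FiniteType k B]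
    (hdim : ringKrullDim B = 2) {ρ : kˣ →* (B ≃ₐ[k] B)}
    {x : L} (hx : x ∈ weightSpace (fractionAction L ρ) 1) (hx0 : x ≠ 0) :
    Algebra.trdeg k (invariantField (fractionAction L ρ)) ≤ 1 := by
  have h1 : Algebra.trdeg k L ≤ 2 := by
    have : Algebra.IsAlgebraic B L := IsLocalization.isAlgebraic L (nonZeroDivisors B)
    have : FaithfulSMul k B := inferInstance
    rw [← trdeg_add_eq k B, trdeg_eq_zero (R := B), add_zero]
    exact_mod_cast trdeg_le_of_ringKrullDim_eq (n := 2) hdim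
  rw [← trdeg_add_eq k (invariantField (fractionAction L ρ))] at h1
  have h2 : 1 ≤ Algebra.trdeg (invariantField (fractionAction L ρ)) L := by
    have : Algebra.Transcendental (invariantField (fractionAction L ρ)) L :=
      ⟨x, transcendental_of_mem_weightSpace hx hx0⟩
    exact Cardinal.one_le_iff_pos.mpr (trdeg_pos _ _)
  have h3 := (add_le_add_right h2 _).trans h1
  rw [← one_add_one_eq_two] at h3
  exact (Cardinal.add_le_add_iff_of_lt_aleph0 Cardinal.one_lt_aleph0).mp h3

theorem isAlgebraic_invariants [CharZero k] [IsAlgClosed k] [IsDomain B] [Algebra.FiniteType k B]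
    (hdim : ringKrullDim B = 2) {ρ : kˣ →* (B ≃ₐ[k] B)} (hell : ¬ IsElliptic ρ)
    {x : L} (hx : x ∈ weightSpace (fractionAction L ρ) 1) (hx0 : x ≠ 0) :
    Algebra.IsAlgebraic (invariants ρ) (invariantField (fractionAction L ρ)) := by
  have h1 := trdeg_invariantField_le hdim hx hx0
  rw [← trdeg_add_eq k (invariants ρ)] at h1
  have h2 : 1 ≤ Algebra.trdeg k (invariants ρ) := by
    obtain ⟨r, hr⟩ := exists_transcendental_of_not_isElliptic hell
    have : Algebra.Transcendental k (invariants ρ) := ⟨r, hr⟩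
    exact Cardinal.one_le_iff_pos.mpr (trdeg_pos _ _)
  have h3 := (add_le_add_left h2 _).trans h1
  rw [← trdeg_eq_zero_iff]
  rw [add_comm] at h3
  nth_rewrite 2 [← zero_add 1] at h3
  exact le_zero_iff.mp ((Cardinal.add_le_add_iff_of_lt_aleph0 Cardinal.one_lt_aleph0).mp h3)

/-- A domain of transcendence degree at most one over an algebraically closed field has dimension
at most one. -/
theorem dimensionLEOne_of_trdeg_le_one {S : Type*} [CommRing S] [IsDomain S] [IsAlgClosed k]
    [Algebra k S] (h : Algebra.trdeg k S ≤ 1) : Ring.DimensionLEOne S := by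
  refine ⟨fun {p} hp0 hp => ?_⟩
  obtain ⟨q, hq, hq0⟩ := Submodule.exists_mem_ne_zero_of_ne_bot hp0
  -- The residue ring at `p` is `k`: every `r` is a root modulo `p` of a nonzero polynomial over
  -- `k`, which splits.
  have key : ∀ r : S, ∃ a : k, r - algebraMap k S a ∈ p := by
    intro r
    obtain ⟨g, hg0, hg⟩ : ∃ g : Polynomial k, g ≠ 0 ∧ Polynomial.aeval r g ∈ p := by
      by_cases hr : IsAlgebraic k r
      · obtain ⟨g, hg0, hg⟩ := hr
        exact ⟨g, hg0, hg ▸ p.zero_mem⟩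
      -- A transcendental `r` is a transcendence basis, so `q ∈ p` divides a nonzero element of
      -- `k[r]`.
      have hi : AlgebraicIndependent k (fun _ : Unit => r) :=
        algebraicIndependent_unique_type_iff.mpr hr
      have hb := hi.isTranscendenceBasis_of_lift_trdeg_le_of_finite (by simpa using h)
      have := hb.isAlgebraic
      obtain ⟨y, hy0, hy⟩ := IsAlgebraic.exists_nonzero_dvd
        (Algebra.IsAlgebraic.isAlgebraic
          (R := Algebra.adjoin k (Set.range fun _ : Unit => r)) q) (mem_nonZeroDivisors_of_ne_zero hq0)
      obtain ⟨y, hy'⟩ := y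
      have hy'' := hy'
      rw [Set.range_const, Algebra.adjoin_singleton_eq_range_aeval] at hy''
      obtain ⟨g, rfl⟩ := hy''
      refine ⟨g, ?_, p.mem_of_dvd hy hq⟩
      rintro rfl
      exact hy0 (Subtype.ext (map_zero _))
    have hs := (IsAlgClosed.splits g).eq_prod_roots
    rw [hs, map_mul, Polynomial.aeval_C, map_multiset_prod, Multiset.map_map] at hg
    rcases hp.mem_or_mem hg with hg | hg
    · exact absurd (p.eq_top_of_isUnit_mem hg
        ((IsUnit.mk0 _ (Polynomial.leadingCoeff_ne_zero.mpr hg0)).map _)) hp.ne_top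
    · obtain ⟨y, hy, hyp⟩ := (hp.multiset_prod_mem_iff_exists_mem _).mp hg
      obtain ⟨a, -, rfl⟩ := Multiset.mem_map.mp hy
      exact ⟨a, by simpa using hyp⟩
  refine Ideal.isMaximal_iff.mpr ⟨(Ideal.ne_top_iff_one p).mp hp.ne_top, fun J x hJ hx hxJ => ?_⟩
  obtain ⟨a, ha⟩ := key x
  have ha0 : a ≠ 0 := by
    rintro rfl
    exact hx (by simpa using ha)
  have h1 : algebraMap k S a ∈ J := by
    have := J.sub_mem hxJ (hJ ha)
    rwa [sub_sub_cancel] at this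
  rw [← Ideal.eq_top_iff_one]
  exact J.eq_top_of_isUnit_mem h1 ((IsUnit.mk0 _ ha0).map _)

/-- The projection onto the component of weight 0 is linear over the invariants and maps the
extension of `J` into `J`. -/
theorem comap_map_invariants [CharZero k] [IsDomain B]
    {ρ : kˣ →* (B ≃ₐ[k] B)} (hρ : IsAlgebraicAction ρ) (J : Ideal (invariants ρ)) :
    (J.map (algebraMap (invariants ρ) B)).comap (algebraMap (invariants ρ) B) = J := by
  refine le_antisymm (fun y hy => ?_) Ideal.le_comap_map
  -- The multiplier `b` is part of the statement so that the scalar case of the induction reduces to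
  -- associativity.
  have key : ∀ x ∈ J.map (algebraMap (invariants ρ) B), ∀ b : B, ∃ c : ℤ →₀ B,
      (∀ m, c m ∈ weightSpace ρ m) ∧ (∃ j ∈ J, (j : B) = c 0) ∧ c.sum (fun _ x => x) = b * x := by
    intro x hx
    induction hx using Submodule.span_induction with
    | mem x hx =>
      obtain ⟨j, hj, rfl⟩ := hx
      intro b
      obtain ⟨c, hc, hcb⟩ := exists_sum_weight_eq hρ b
      refine ⟨c.mapRange (fun x => x * j) (zero_mul _), fun m => ?_,
        ⟨⟨c 0, hc 0⟩ * j, J.mul_mem_left _ hj, rfl⟩, ?_⟩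
      · rw [Finsupp.mapRange_apply, ← add_zero m]
        exact mul_mem_weightSpace (by simpa using hc m) j.2
      · rw [Finsupp.sum_mapRange_index (fun _ => rfl), ← hcb, Finset.sum_mul]
        rfl
    | zero => exact fun b => ⟨0, fun m => zero_mem _, ⟨0, zero_mem _, rfl⟩, by simp⟩
    | add x y _ _ hx hy =>
      intro b
      obtain ⟨c, hc, ⟨j, hj, hjc⟩, hcb⟩ := hx b
      obtain ⟨c', hc', ⟨j', hj', hjc'⟩, hcb'⟩ := hy b
      refine ⟨c + c', fun m => add_mem (hc m) (hc' m), ⟨j + j', add_mem hj hj', ?_⟩, ?_⟩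
      · rw [Finsupp.add_apply, ← hjc, ← hjc']; rfl
      · rw [Finsupp.sum_add_index' (fun _ => rfl) (fun _ _ _ => rfl), hcb, hcb', mul_add]
    | smul a x _ hx =>
      intro b
      rw [smul_eq_mul, ← mul_assoc]
      exact hx (b * a)
  obtain ⟨c, hc, ⟨j, hj, hjc⟩, hcy⟩ := key _ hy 1
  let d : ℤ →₀ B := c - Finsupp.single 0 (y : B)
  have h := eq_zero_of_sum_weight_eq_zero (ρ := ρ) (w := fun m : ℤ => m)
    (s := d.support) (x := d)
    Function.injective_id (fun m _ => ?_) ?_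
  · have h0 : c 0 - (y : B) = 0 := by
      by_contra h0
      exact h0 (by simpa [d] using h 0 (by simpa [d] using h0))
    rwa [show y = j from Subtype.ext (by rw [hjc, sub_eq_zero.mp h0])]
  · rw [show d = c - Finsupp.single 0 (y : B) from rfl, Finsupp.sub_apply, Finsupp.single_apply]
    split_ifs with h
    · exact sub_mem (hc m) (h ▸ y.2)
    · exact sub_mem (hc m) (zero_mem _)
  · change (c - Finsupp.single 0 (y : B)).sum (fun _ x => x) = 0
    rw [Finsupp.sum_sub_index fun _ _ _ => rfl, hcy, Finsupp.sum_single_index rfl, one_mul]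
    exact sub_self _

/-- Extension of ideals to `B` is strictly increasing, so ascending chains stop. -/
theorem isNoetherianRing_invariants [CharZero k] [IsDomain B] [IsNoetherianRing B]
    {ρ : kˣ →* (B ≃ₐ[k] B)} (hρ : IsAlgebraicAction ρ) : IsNoetherianRing (invariants ρ) := by
  have hmono : StrictMono fun J : Ideal (invariants ρ) => J.map (algebraMap (invariants ρ) B) :=
    Monotone.strictMono_of_injective (fun _ _ h => Ideal.map_mono h)
      (Function.LeftInverse.injective (g := Ideal.comap (algebraMap (invariants ρ) B))
        fun J => comap_map_invariants hρ J)
  exact isNoetherian_iff'.mpr hmono.wellFoundedGT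

end Dim

/-! ### `B` as a graded subalgebra of Laurent polynomials -/

section LaurentAlgebra

universe u v

variable {k : Type u} {B L : Type v} [Field k] [CommRing B] [Algebra k B]
  [Field L] [Algebra B L] [IsFractionRing B L] [Algebra k L] [IsScalarTower k B L]

/-- The field of invariants is algebraic over the ring of invariants, by transcendence degrees, and
the ring is integrally closed in it. -/
theorem isFractionRing_invariants [CharZero k] [IsAlgClosed k] [IsDomain B] [IsIntegrallyClosed B]
    [Algebra.FiniteType k B] (hdim : ringKrullDim B = 2) {ρ : kˣ →* (B ≃ₐ[k] B)}
    (hell : ¬ IsElliptic ρ) {x : L} (hx : x ∈ weightSpace (fractionAction L ρ) 1) (hx0 : x ≠ 0) :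
    IsFractionRing (invariants ρ) (invariantField (fractionAction L ρ)) := by
  have := isAlgebraic_invariants hdim hell hx hx0
  have hinj : Function.Injective
      (algebraMap (invariants ρ) (invariantField (fractionAction L ρ))) :=
    FaithfulSMul.algebraMap_injective _ _
  have : IsIntegralClosure (invariants ρ) (invariants ρ) (invariantField (fractionAction L ρ)) :=
    ⟨hinj, ⟨fun h => exists_algebraMap_eq_of_isIntegral h, by
      rintro ⟨y, rfl⟩
      exact isIntegral_algebraMap⟩⟩
  exact IsIntegralClosure.isFractionRing_of_algebraic (invariants ρ) (invariants ρ)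
    fun y hy => hinj (by rw [hy, map_zero])

theorem isDedekindDomain_invariants [CharZero k] [IsAlgClosed k] [IsDomain B]
    [IsIntegrallyClosed B] [Algebra.FiniteType k B] (hdim : ringKrullDim B = 2)
    {ρ : kˣ →* (B ≃ₐ[k] B)} (hρ : IsAlgebraicAction ρ) (hell : ¬ IsElliptic ρ) {x : L}
    (hx : x ∈ weightSpace (fractionAction L ρ) 1) (hx0 : x ≠ 0) :
    IsDedekindDomain (invariants ρ) := by
  have := isFractionRing_invariants hdim hell hx hx0
  have : IsNoetherianRing B := Algebra.FiniteType.isNoetherianRing k B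
  refine (isDedekindDomain_iff _ (invariantField (fractionAction L ρ))).mpr
    ⟨inferInstance, isNoetherianRing_invariants hρ, dimensionLEOne_of_trdeg_le_one (k := k) ?_,
      exists_algebraMap_eq_of_isIntegral⟩
  exact (trdeg_le_of_injective
    (IsScalarTower.toAlgHom k (invariants ρ) (invariantField (fractionAction L ρ)))
    (FaithfulSMul.algebraMap_injective _ _)).trans (trdeg_invariantField_le hdim hx hx0)

/-- A field of invariants would embed in a residue field of `B`, which is finite over `k` by the
Nullstellensatz; but some invariant is transcendental. -/
theorem not_isField_invariants [IsAlgClosed k] [IsDomain B] [Algebra.FiniteType k B]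
    {ρ : kˣ →* (B ≃ₐ[k] B)} (hell : ¬ IsElliptic ρ) : ¬ IsField (invariants ρ) := by
  intro hf
  obtain ⟨r, hr⟩ := exists_transcendental_of_not_isElliptic hell
  obtain ⟨m, hm⟩ := Ideal.exists_maximal B
  let := Ideal.Quotient.field m
  have : Module.Finite k (B ⧸ m) := finite_of_finite_type_of_isJacobsonRing k (B ⧸ m)
  let f : invariants ρ →ₐ[k] B ⧸ m := (Ideal.Quotient.mkₐ k m).comp (invariants ρ).val
  let := hf.toField
  have hinj : Function.Injective f := f.toRingHom.injective
  exact hr ((isAlgebraic_algHom_iff f hinj).mp (Algebra.IsAlgebraic.isAlgebraic (f r)))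

variable (ρ : kˣ →* (B ≃ₐ[k] B)) {x : L}

/-- The evaluation of Laurent polynomials over the field of invariants at `x`. -/
def evalHom (hx0 : x ≠ 0) :
    AddMonoidAlgebra (invariantField (fractionAction L ρ)) (Fin 1 → ℤ) →ₐ[
      invariantField (fractionAction L ρ)] L :=
  AddMonoidAlgebra.lift _ _ _
    { toFun m := x ^ (m.toAdd 0)
      map_one' := by simp
      map_mul' a b := by simp [zpow_add₀ hx0] }

theorem evalHom_single (hx0 : x ≠ 0) (m : Fin 1 → ℤ) (f : invariantField (fractionAction L ρ)) :
    evalHom ρ hx0 (AddMonoidAlgebra.single m f) = f * x ^ (m 0) := by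
  rw [evalHom, AddMonoidAlgebra.lift_single, Algebra.smul_def]
  rfl

theorem evalHom_apply (hx0 : x ≠ 0)
    (F : AddMonoidAlgebra (invariantField (fractionAction L ρ)) (Fin 1 → ℤ)) :
    evalHom ρ hx0 F = ∑ m ∈ F.coeff.support, (F.coeff m : L) * x ^ (m 0) := by
  rw [evalHom, AddMonoidAlgebra.lift_apply, Finsupp.sum]
  refine Finset.sum_congr rfl fun m _ => ?_
  rw [Algebra.smul_def]
  rfl

theorem evalHom_injective [CharZero k] (hx : x ∈ weightSpace (fractionAction L ρ) 1)
    (hx0 : x ≠ 0) : Function.Injective (evalHom ρ hx0) := by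
  refine (injective_iff_map_eq_zero _).mpr fun F hF => ?_
  rw [evalHom_apply] at hF
  have h := eq_zero_of_sum_weight_eq_zero (ρ := fractionAction L ρ)
    (w := fun m : Fin 1 → ℤ => m 0) (fun a b h => by ext i; rwa [Subsingleton.elim i 0])
    (fun m _ => by simpa using mul_mem_weightSpace (F.coeff m).2 (zpow_mem_weightSpace hx (m 0))) hF
  ext m
  by_contra hm
  have hm' : F.coeff m ≠ 0 := fun h0 => hm (by rw [h0]; rfl)
  have := h m (Finsupp.mem_support_iff.mpr hm')
  rw [mul_eq_zero] at this
  exact hm' (Subtype.ext (this.resolve_right (zpow_ne_zero _ hx0)))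

/-- The algebra `B` as a graded algebra of Laurent polynomials over the field of invariants. -/
def laurentAlgebra (hx0 : x ≠ 0) : Subalgebra (invariants ρ)
    (AddMonoidAlgebra (invariantField (fractionAction L ρ)) (Fin 1 → ℤ)) :=
  (IsScalarTower.toAlgHom (invariants ρ) B L).range.comap
    ((evalHom ρ hx0).restrictScalars (invariants ρ))

theorem mem_laurentAlgebra (hx0 : x ≠ 0)
    {F : AddMonoidAlgebra (invariantField (fractionAction L ρ)) (Fin 1 → ℤ)} :
    F ∈ laurentAlgebra ρ hx0 ↔ ∃ b, algebraMap B L b = evalHom ρ hx0 F := Iff.rfl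

/-- The torus action on Laurent polynomials corresponds to `ρ`, because `x` has weight 1 and the
coefficients are invariant. -/
theorem evalHom_twist (hx : x ∈ weightSpace (fractionAction L ρ) 1) (hx0 : x ≠ 0) (u : kˣ)
    (F : AddMonoidAlgebra (invariantField (fractionAction L ρ)) (Fin 1 → ℤ)) :
    evalHom ρ hx0 (twist (coordChar (R := invariants ρ) u (0 : Fin 1)) F) =
      fractionAction L ρ u (evalHom ρ hx0 F) := by
  have key : ∀ (m : Fin 1 → ℤ) (f : invariantField (fractionAction L ρ)),
      evalHom ρ hx0 (twist (coordChar (R := invariants ρ) u (0 : Fin 1)) (AddMonoidAlgebra.single m f)) =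
        fractionAction L ρ u (evalHom ρ hx0 (AddMonoidAlgebra.single m f)) := by
    intro m f
    have h1 : twist (coordChar (R := invariants ρ) u (0 : Fin 1)) (AddMonoidAlgebra.single m f) =
        AddMonoidAlgebra.single m (algebraMap k (invariantField (fractionAction L ρ))
          ((u ^ (m 0) : kˣ) : k) * f) := by
      ext m'
      rw [coeff_twist, AddMonoidAlgebra.coeff_single, AddMonoidAlgebra.coeff_single,
        Finsupp.single_apply, Finsupp.single_apply]
      split_ifs with h
      · rw [← h, IsScalarTower.algebraMap_apply k (invariants ρ)]
        rfl
      · rw [mul_zero]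
    rw [h1, evalHom_single, evalHom_single, map_mul, f.2 u, zpow_mem_weightSpace hx _ u, zpow_zero,
      Units.val_one, one_smul, Algebra.smul_def]
    push_cast
    rw [mul_comm _ (f : L), mul_assoc]
    rfl
  induction F using AddMonoidAlgebra.induction_linear with
  | zero => simp only [map_zero]
  | add F G hF hG => simp only [map_add, hF, hG]
  | single m f => exact key m f

/-- Dividing the component of weight `i` by `x ^ i` makes it invariant. -/
theorem exists_sum_single_eq [CharZero k] [IsDomain B] (hρ : IsAlgebraicAction ρ)
    (hx : x ∈ weightSpace (fractionAction L ρ) 1) (hx0 : x ≠ 0) (b : B) :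
    ∃ (s : Finset ℤ) (f : ℤ → invariantField (fractionAction L ρ)),
      (∀ i ∈ s, AddMonoidAlgebra.single (fun _ => i) (f i) ∈ laurentAlgebra ρ hx0) ∧
      evalHom ρ hx0 (∑ i ∈ s, AddMonoidAlgebra.single (fun _ => i) (f i)) = algebraMap B L b := by
  obtain ⟨c, hc, hcb⟩ := exists_sum_weight_eq hρ b
  have h : ∀ i, algebraMap B L (c i) * x ^ (-i) ∈ weightSpace (fractionAction L ρ) 0 := fun i => by
    simpa using mul_mem_weightSpace (algebraMap_mem_weightSpace_iff.mpr (hc i))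
      (zpow_mem_weightSpace hx (-i))
  have h1 : ∀ i, evalHom ρ hx0 (AddMonoidAlgebra.single (fun _ => i) ⟨_, h i⟩) =
      algebraMap B L (c i) := fun i => by
    rw [evalHom_single, mul_assoc, ← zpow_add₀ hx0, neg_add_cancel, zpow_zero, mul_one]
  refine ⟨c.support, fun i => ⟨_, h i⟩, fun i _ => ⟨c i, (h1 i).symm⟩, ?_⟩
  rw [map_sum, ← hcb, map_sum]
  exact Finset.sum_congr rfl fun i _ => h1 i

theorem single_coeff_mem_laurentAlgebra [CharZero k] [IsDomain B] (hρ : IsAlgebraicAction ρ)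
    (hx : x ∈ weightSpace (fractionAction L ρ) 1) (hx0 : x ≠ 0)
    {F : AddMonoidAlgebra (invariantField (fractionAction L ρ)) (Fin 1 → ℤ)}
    (hF : F ∈ laurentAlgebra ρ hx0) (m : Fin 1 → ℤ) :
    AddMonoidAlgebra.single m (F.coeff m) ∈ laurentAlgebra ρ hx0 := by
  obtain ⟨b, hb⟩ := (mem_laurentAlgebra ρ hx0).mp hF
  obtain ⟨s, f, hf, hs⟩ := exists_sum_single_eq ρ hρ hx hx0 b
  rw [evalHom_injective ρ hx hx0 (hb.symm.trans hs.symm)]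
  clear hs hb hF
  classical
  induction s using Finset.induction_on with
  | empty => simp
  | insert i s hi ih =>
    rw [Finset.sum_insert hi, AddMonoidAlgebra.coeff_add, Finsupp.add_apply,
      AddMonoidAlgebra.single_add]
    refine add_mem ?_ (ih fun j hj => hf j (Finset.mem_insert_of_mem hj))
    rw [AddMonoidAlgebra.coeff_single, Finsupp.single_apply]
    split_ifs with h
    · exact h ▸ hf i (Finset.mem_insert_self i s)
    · simp

theorem isGradedIdeal_top_laurentAlgebra [CharZero k] [IsDomain B] (hρ : IsAlgebraicAction ρ)
    (hx : x ∈ weightSpace (fractionAction L ρ) 1) (hx0 : x ≠ 0) :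
    IsGradedIdeal (⊤ : Ideal (laurentAlgebra ρ hx0)) := fun F _ m =>
  ⟨⟨_, single_coeff_mem_laurentAlgebra ρ hρ hx hx0 F.2 m⟩, trivial, rfl⟩

/-- An element of the fraction field with a positive power in the normal ring `B` lies in `B`. -/
theorem isRootClosed_laurentAlgebra [IsIntegrallyClosed B] (hx0 : x ≠ 0) :
    IsRootClosed (laurentAlgebra ρ hx0) := by
  rintro N m f hN ⟨b, hb⟩
  have hb' : algebraMap B L b = evalHom ρ hx0 (AddMonoidAlgebra.single (N • m) (f ^ N)) := hb
  rw [evalHom_single] at hb'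
  have h1 : IsIntegral B ((f : L) * x ^ (m 0)) := by
    refine IsIntegral.of_pow hN ?_
    rw [mul_pow, ← zpow_natCast, ← zpow_natCast, ← zpow_mul, mul_comm (m 0)]
    have : (f : L) ^ (N : ℤ) * x ^ ((N : ℤ) * m 0) = algebraMap B L b := by
      rw [hb']
      simp
    rw [this]
    exact isIntegral_algebraMap
  obtain ⟨c, hc⟩ := IsIntegrallyClosed.isIntegral_iff.mp h1
  exact ⟨c, hc.trans (evalHom_single ρ hx0 m f).symm⟩

theorem exists_ringEquiv_laurentAlgebra [CharZero k] [IsDomain B] (hρ : IsAlgebraicAction ρ)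
    (hx : x ∈ weightSpace (fractionAction L ρ) 1) (hx0 : x ≠ 0) :
    ∃ e : laurentAlgebra ρ hx0 ≃+* B, ∀ F, algebraMap B L (e F) = evalHom ρ hx0 F := by
  choose g hg using fun F : laurentAlgebra ρ hx0 => (mem_laurentAlgebra ρ hx0).mp F.2
  have hB := IsFractionRing.injective B L
  let θ : laurentAlgebra ρ hx0 →+* B :=
    { toFun := g
      map_one' := hB (by rw [hg]; simp)
      map_mul' _ _ := hB (by rw [hg, map_mul, hg, hg]; simp)
      map_zero' := hB (by rw [hg]; simp)
      map_add' _ _ := hB (by rw [hg, map_add, hg, hg]; simp) }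
  refine ⟨RingEquiv.ofBijective θ ⟨fun F G h => ?_, fun b => ?_⟩, hg⟩
  · refine Subtype.ext (evalHom_injective ρ hx hx0 ?_)
    rw [← hg F, ← hg G]
    exact congrArg _ h
  · obtain ⟨s, f, hf, hs⟩ := exists_sum_single_eq ρ hρ hx hx0 b
    exact ⟨⟨_, sum_mem hf⟩, hB ((hg _).trans hs)⟩

end LaurentAlgebra

/-! ### Normal ideals on surfaces with an action of the multiplicative group -/

section Transport

variable {A A' : Type*} [CommRing A] [CommRing A']

theorem IsIntegralOverIdeal.map {I : Ideal A} {a : A} (h : IsIntegralOverIdeal I a)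
    (f : A →+* A') : IsIntegralOverIdeal (I.map f) (f a) := by
  obtain ⟨r, hr, l, hl, h⟩ := h
  refine ⟨r, hr, fun i => f (l i), fun i hi => ?_, ?_⟩
  · rw [← Ideal.map_pow]
    exact Ideal.mem_map_of_mem f (hl i hi)
  · rw [← map_zero f, ← h]
    simp

theorem IsIntegrallyClosedIdeal.map_equiv {I : Ideal A} (h : IsIntegrallyClosedIdeal I)
    (e : A ≃+* A') : IsIntegrallyClosedIdeal (I.map (e : A →+* A')) := by
  intro a ha
  have h1 := ha.map (e.symm : A' →+* A)
  rw [Ideal.map_map, RingEquiv.symm_comp, Ideal.map_id] at h1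
  simpa using Ideal.mem_map_of_mem (e : A →+* A') (h _ h1)

theorem IsNormalIdeal.map_equiv {I : Ideal A} (h : IsNormalIdeal I) (e : A ≃+* A') :
    IsNormalIdeal (I.map (e : A →+* A')) := fun r hr => by
  rw [← Ideal.map_pow]
  exact (h r hr).map_equiv e

theorem IsIntegrallyClosedIdeal.idealClosure_eq {I : Ideal A} (h : IsIntegrallyClosedIdeal I) :
    idealClosure I = I :=
  le_antisymm h fun a ha => ⟨1, le_rfl, fun _ => -a, by simpa using ha, by simp⟩

end Transport

section Surface

universe u v

variable {k : Type u} {B L : Type v} [Field k] [CommRing B] [Algebra k B]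
  [Field L] [Algebra B L] [IsFractionRing B L] [Algebra k L] [IsScalarTower k B L]
  (ρ : kˣ →* (B ≃ₐ[k] B)) {x : L}

/-- Stability under `ρ` becomes stability under the torus; the element `2` alone suffices. -/
theorem isGradedIdeal_map_symm [CharZero k] (hx : x ∈ weightSpace (fractionAction L ρ) 1)
    (hx0 : x ≠ 0) {J : Ideal B} (hJ : ∀ t : kˣ, ∀ b ∈ J, ρ t b ∈ J)
    (e : laurentAlgebra ρ hx0 ≃+* B) (he : ∀ F, algebraMap B L (e F) = evalHom ρ hx0 F) :
    IsGradedIdeal (J.map (e.symm : B →+* laurentAlgebra ρ hx0)) := by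
  refine isGradedIdeal_of_stable (Units.mk0 (2 : k) two_ne_zero) two_zpow_injective
    fun i F hF => ?_
  have hF' : e F ∈ J := by
    have h1 := Ideal.mem_map_of_mem (e : laurentAlgebra ρ hx0 →+* B) hF
    rw [Ideal.map_map, RingEquiv.comp_symm, Ideal.map_id] at h1
    exact h1
  refine ⟨e.symm (ρ (Units.mk0 (2 : k) two_ne_zero) (e F)),
    Ideal.mem_map_of_mem (e.symm : B →+* laurentAlgebra ρ hx0) (hJ _ _ hF'), fun m => ?_⟩
  have h2 : (e.symm (ρ (Units.mk0 (2 : k) two_ne_zero) (e F)) :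
      AddMonoidAlgebra (invariantField (fractionAction L ρ)) (Fin 1 → ℤ)) =
      twist (coordChar (R := invariants ρ) (Units.mk0 (2 : k) two_ne_zero) (0 : Fin 1)) F := by
    apply evalHom_injective ρ hx hx0
    rw [evalHom_twist ρ hx hx0, ← he, ← he, RingEquiv.apply_symm_apply, fractionAction_algebraMap]
  rw [h2, coeff_twist, Subsingleton.elim i 0]
  rfl

theorem isNormalIdeal_of_stable [CharZero k] [IsAlgClosed k] [IsDomain B] [IsIntegrallyClosed B]
    [Algebra.FiniteType k B] (hdim : ringKrullDim B = 2)
    (hρ : IsAlgebraicAction ρ) (hinj : Function.Injective ρ) (hell : ¬ IsElliptic ρ)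
    {J : Ideal B} (hJ : ∀ t : kˣ, ∀ b ∈ J, ρ t b ∈ J) (hJc : IsIntegrallyClosedIdeal J) :
    IsNormalIdeal J := by
  obtain ⟨x, hx0, hx⟩ := exists_mem_weightSpace_one (L := FractionRing B) hρ hinj
  obtain ⟨e, he⟩ := exists_ringEquiv_laurentAlgebra ρ hρ hx hx0
  have := isDedekindDomain_invariants hdim hρ hell hx hx0
  have := isFractionRing_invariants hdim hell hx hx0
  -- The grading group is `ℤ`, so `n = 1` and the exponent `e = 1` is allowed; the ideal is its own
  -- integral closure.
  have h := isNormalIdeal_idealClosure_pow k (not_isField_invariants hell)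
    (isGradedIdeal_top_laurentAlgebra ρ hρ hx hx0) (isRootClosed_laurentAlgebra ρ hx0)
    (isGradedIdeal_map_symm ρ hx hx0 hJ e he) (e := 1) (by simp)
  rw [pow_one, (hJc.map_equiv e.symm).idealClosure_eq] at h
  have h1 := h.map_equiv e
  rwa [Ideal.map_map, RingEquiv.comp_symm, Ideal.map_id] at h1

end Surface

end ComplexityOne

end

open ComplexityOne

theorem mainTheorem5 (k : Type*) [Field k] [IsAlgClosed k] [CharZero k] :
    (∀ (R : Type*) [CommRing R] [IsDedekindDomain R] [Algebra k R] [Algebra.FiniteType k R]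
      (_ : ¬ IsField R) (K : Type*) [Field K] [Algebra R K] [IsFractionRing R K]
      (n : ℕ) (σ : PointedCone ℚ (Fin n → ℚ)) (_ : σ.FG)
      (_ : (σ : ConvexCone ℚ (Fin n → ℚ)).Salient)
      (D : PolyhedralDivisor R σ) (I : Ideal (D.algebra K)),
      D.IsHomogeneousIdeal K I → IsIntegrallyClosedIdeal I →
      (∀ (P : Set (Fin n → ℚ)) (D' : PolyhedralDivisor R (dualCone (reesCone σ P))),
        D.IsAssociatedPair K I P D' →
        (∀ z ∈ D'.support, IsNormalPolyhedron (D'.localPolyhedron P z)) →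
        (D'.support = ∅ → IsNormalPolyhedron P) →
        IsNormalIdeal I) ∧
      (∀ e : ℕ, n ≤ e → IsNormalIdeal (idealClosure (I ^ e)))) ∧
    (∀ (B : Type*) [CommRing B] [IsDomain B] [IsIntegrallyClosed B] [Algebra k B]
      [Algebra.FiniteType k B] (_ : ringKrullDim B = 2)
      (ρ : kˣ →* (B ≃ₐ[k] B)) (_ : IsAlgebraicAction ρ) (_ : Function.Injective ρ)
      (_ : ¬ IsElliptic ρ) (J : Ideal B) (_ : ∀ t : kˣ, ∀ b ∈ J, ρ t b ∈ J),
      IsIntegrallyClosedIdeal J → IsNormalIdeal J) := by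
  refine ⟨fun R _ _ _ _ hR K _ _ _ n σ _ _ D I hI _ => ⟨fun P D' h hsupp hempty => ?_,
    fun e he => ?_⟩, fun B _ _ _ _ _ hdim ρ hρ hinj hell J hJ hJc =>
      isNormalIdeal_of_stable ρ hdim hρ hinj hell hJ hJc⟩
  · exact h.isNormalIdeal k hR hI.isGradedIdeal hsupp hempty
  · exact isNormalIdeal_idealClosure_pow k hR D.isGradedIdeal_top D.isRootClosed_algebra
      hI.isGradedIdeal (by simpa using he)
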